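/- Let $\psi_b:\mathbb{R}\to\mathbb{R}$ be twice differentiable with $|\psi_b|_\infty+|\psi_b'|_\infty+|\psi_b''|_\infty<\infty$, set $\psi(z)=\tfrac12 z^2+\psi_b(z)$, and let $R\in\mathbb{N}$ and $\delta>0$. Then there is a constant $C\in(0,\infty)$, depending only on $\psi_b$, $R$ and $\delta$, such that the following holds for every $N\ge 1$, every $s\in\mathbb{R}^N$, every $\sigma\in\mathbb{R}$ and every real matrix $M=(M_{ij})_{1\le i,j\le N}$, with off-diagonal entries of arbitrary sign, that satisfies $M_{ii}=1$ and $M_{ij}=M_{ji}$ for all $i,j$, $M_{ij}=0$ whenever $|i-j|>R$, and $$\sum_{j:\,1\le|j-i|\le R}|M_{ij}|+\delta\le M_{ii}=1\qquad\text{for all } 1\le i\le N.$$ Let $$H(x)=\sum_{i=1}^N\Big(\psi(x_i)+s_ix_i+\tfrac12\sum_{j:\,1\le|j-i|\le R}M_{ij}x_ix_j\Big),\qquad x\in\mathbb{R}^N,$$ where $j$ ranges over $\{1,\dots,N\}$. Then the grand canonical ensemble $$\mu^\sigma(dx)=\frac1Z\exp\Big(\sigma\sum_{k=1}^Nx_k-H(x)\Big)dx$$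 is a well-defined probability measure on $\mathbb{R}^N$, the sum $\sum_{k=1}^N X_k$ of the coordinates of $X\sim\mu^\sigma$ is square integrable, and $$\frac1C\le\frac1N\operatorname{Var}_{\mu^\sigma}\Big(\sum_{k=1}^NX_k\Big)\le C.$$ -/

import Mathlib

open MeasureTheory ProbabilityTheory

noncomputable section

namespace SpinSystem

/-- The perturbation `ψb` of the quadratic single-site potential: it is twice differentiable and
`|ψb|_∞ + |ψb'|_∞ + |ψb''|_∞ < ∞`. -/
structure IsBoundedPerturbation (ψb : ℝ → ℝ) : Prop where
  differentiable : Differentiable ℝ ψb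
  differentiable_deriv : Differentiable ℝ (deriv ψb)
  bounded : ∃ K : ℝ, ∀ z : ℝ, |ψb z| ≤ K
  bounded_deriv : ∃ K : ℝ, ∀ z : ℝ, |deriv ψb z| ≤ K
  bounded_deriv_deriv : ∃ K : ℝ, ∀ z : ℝ, |deriv (deriv ψb) z| ≤ K

/-- The sites `j` with `1 ≤ |j - i| ≤ R`. -/
def neighbors {N : ℕ} (R : ℕ) (i : Fin N) : Finset (Fin N) :=
  Finset.univ.filter fun j : Fin N =>
    1 ≤ |((j : ℕ) : ℤ) - ((i : ℕ) : ℤ)| ∧ |((j : ℕ) : ℤ) - ((i : ℕ) : ℤ)| ≤ (R : ℤ)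

/-- Symmetric interaction matrices of range `R`, with unit diagonal, that are strictly diagonally
dominant with margin `δ`. The off-diagonal entries may have any sign. -/
structure IsInteraction (R : ℕ) (δ : ℝ) {N : ℕ} (M : Matrix (Fin N) (Fin N) ℝ) : Prop where
  diag : ∀ i, M i i = 1
  symm : ∀ i j, M i j = M j i
  range : ∀ i j : Fin N, (R : ℤ) < |((i : ℕ) : ℤ) - ((j : ℕ) : ℤ)| → M i j = 0
  dominant : ∀ i, ∑ j ∈ neighbors R i, |M i j| + δ ≤ M i i

/-- The single-site potential `ψ(z) = z² / 2 + ψb(z)`. -/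
def singleSite (ψb : ℝ → ℝ) (z : ℝ) : ℝ := 1 / 2 * z ^ 2 + ψb z

/-- `H(x) = ∑ i, (ψ(x i) + s i * x i + (1/2) ∑_{j : 1 ≤ |j - i| ≤ R} M i j * x i * x j)`. -/
def hamiltonian (ψb : ℝ → ℝ) (R : ℕ) {N : ℕ} (M : Matrix (Fin N) (Fin N) ℝ) (s : Fin N → ℝ)
    (x : Fin N → ℝ) : ℝ :=
  ∑ i, (singleSite ψb (x i) + s i * x i + 1 / 2 * ∑ j ∈ neighbors R i, M i j * x i * x j)

/-- The grand canonical ensemble `μ^σ(dx) = Z⁻¹ exp(σ ∑ k, x k - H(x)) dx` on `ℝ^N`, where `dx` is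
Lebesgue measure and `Z = ∫ exp(σ ∑ k, x k - H(x)) dx`. -/
def gce (ψb : ℝ → ℝ) (R : ℕ) {N : ℕ} (M : Matrix (Fin N) (Fin N) ℝ) (s : Fin N → ℝ) (σ : ℝ) :
    Measure (Fin N → ℝ) :=
  (volume : Measure (Fin N → ℝ)).tilted fun x => σ * ∑ k, x k - hamiltonian ψb R M s x

end SpinSystem

end

noncomputable section

namespace SpinSystem

open Finset Function

set_option linter.unusedSectionVars false

variable {ι : Type*} [Fintype ι] [DecidableEq ι]

/-! The quadratic part of `ψ` is absorbed into the unit diagonal of `M`, so the energy is a bounded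
perturbation plus a linear term plus a coercive quadratic form. The Gibbs density therefore has
Gaussian tails, which gives normalisability and all moments. Write `S` for the total spin and `∂ᵢH`
for the force at site `i`.

Lower bound (`card_le_variance_sum`): integration by parts gives `cov(S, ∑ ∂ᵢH) = N`, while `Var(∑
∂ᵢH) = ∑ᵢⱼ E[∂ᵢ∂ⱼH] ≤ (2 + K) N`. Cauchy–Schwarz then bounds `Var S` below by `N / (2 + K)`.

Upper bound: the system is a chain with finite-range coupling, and it suffices that conditioning on
the left part contracts standard deviations of functions of the right part by a factor `ρ < 1`
uniform in `N`, `s` and `σ` (`HasRange.variance_integral_le`). If `a` bounds the standard deviation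
of a block sum, the influence `D` of the left part on the mean of the sum to its right satisfies
`D_k ≤ ρ (a + D_{k+r})`, hence stays bounded. Each new block then adds only a bounded amount to the
variance.

The contraction is equivalent to saying that a function `g` of the right part cannot be well
approximated by a function of the boundary layer. This is obtained by revealing the layer one site
at a time (`variance_le_of_erase`). As a function of the revealed spin, the conditional mean of `g`
has derivative minus the covariance of `g` with the force there. By Cauchy–Schwarz its square is at
most a constant times the conditional variance of `g`. A Poincaré inequality for the law of that
spin bounds the variance of the conditional mean by the mean of the conditional variance, so
revealing a site costs a fixed factor.

Uniformity comes from diagonal dominance alone, through the maximum principle `IsDominant.abs_le`.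
It bounds single-spin variances (`variance_coord_le`) and shows that the mean force at a frozen site
grows linearly up to a bounded error (`force_increment`), which makes the law of a single spin
nearly log-concave. No sign condition on the coupling enters. -/

/-- Symmetric matrices with unit diagonal and off-diagonal absolute row sums at most `1 - δ`. -/
structure IsDominant (δ : ℝ) (M : Matrix ι ι ℝ) : Prop where
  diag : ∀ i, M i i = 1
  symm : ∀ i j, M i j = M j i
  row : ∀ i, ∑ j, |M i j| ≤ 2 - δ

/-- A common bound for `ψb` and its first two derivatives. -/
structure IsBoundedBy (K : ℝ) (ψb : ℝ → ℝ) : Prop where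
  diff : Differentiable ℝ ψb
  diff_deriv : Differentiable ℝ (deriv ψb)
  bound : ∀ z, |ψb z| ≤ K
  bound_deriv : ∀ z, |deriv ψb z| ≤ K
  bound_deriv_deriv : ∀ z, |deriv (deriv ψb) z| ≤ K

/-- The energy `∑ i, (ψb(x i) + s i * x i) + (1/2) xᵀ M x`. -/
def energy (ψb : ℝ → ℝ) (M : Matrix ι ι ℝ) (s x : ι → ℝ) : ℝ :=
  ∑ i, (ψb (x i) + s i * x i) + 1 / 2 * ∑ i, ∑ j, M i j * (x i * x j)

/-- The partial derivative of the energy in direction `i`. -/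
def grad (ψb : ℝ → ℝ) (M : Matrix ι ι ℝ) (s : ι → ℝ) (i : ι) (x : ι → ℝ) : ℝ :=
  deriv ψb (x i) + s i + ∑ j, M i j * x j

/-! ### Diagonally dominant matrices -/

lemma IsDominant.row_erase {δ : ℝ} {M : Matrix ι ι ℝ} (hM : IsDominant δ M) (i : ι) :
    ∑ j ∈ univ.erase i, |M i j| ≤ 1 - δ := by
  have h := hM.row i
  rw [← Finset.add_sum_erase _ _ (mem_univ i), hM.diag, abs_one] at h
  linarith

/-- Strict diagonal dominance makes the quadratic form coercive. -/
lemma IsDominant.quadratic_ge {δ : ℝ} {M : Matrix ι ι ℝ} (hM : IsDominant δ M) (x : ι → ℝ) :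
    δ * ∑ i, x i ^ 2 ≤ ∑ i, ∑ j, M i j * (x i * x j) := by
  -- Off the diagonal this is `2|ab| ≤ a² + b²`. On the diagonal the term `2 xᵢ²` makes it an
  -- equality, so that both absolute sums may run over full rows, and `2 - (2 - δ) = δ` remains.
  have h1 : ∀ i j, (if i = j then 2 * x i ^ 2 else 0) - |M i j| * (x i ^ 2 / 2)
      - |M i j| * (x j ^ 2 / 2) ≤ M i j * (x i * x j) := by
    intro i j
    split_ifs with h
    · subst h
      rw [hM.diag, abs_one]
      nlinarith
    · have h2 : |M i j * (x i * x j)| ≤ |M i j| * ((x i ^ 2 + x j ^ 2) / 2) := by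
        rw [abs_mul]
        refine mul_le_mul_of_nonneg_left ?_ (abs_nonneg _)
        rw [abs_le]
        constructor <;> nlinarith [sq_nonneg (x i + x j), sq_nonneg (x i - x j)]
      have := neg_abs_le (M i j * (x i * x j))
      linarith
  have h3 : ∑ i, ∑ j, |M i j| * (x i ^ 2 / 2) ≤ (2 - δ) * ∑ i, x i ^ 2 / 2 := by
    rw [Finset.mul_sum]
    refine Finset.sum_le_sum fun i _ => ?_
    rw [← Finset.sum_mul]
    exact mul_le_mul_of_nonneg_right (hM.row i) (by positivity)
  have h4 : ∑ i, ∑ j, |M i j| * (x j ^ 2 / 2) ≤ (2 - δ) * ∑ i, x i ^ 2 / 2 := by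
    rw [Finset.sum_comm]
    refine le_trans (le_of_eq ?_) h3
    refine Finset.sum_congr rfl fun i _ => Finset.sum_congr rfl fun j _ => ?_
    rw [hM.symm]
  have h5 : ∑ i, ∑ j, ((if i = j then 2 * x i ^ 2 else 0) - |M i j| * (x i ^ 2 / 2)
      - |M i j| * (x j ^ 2 / 2)) ≤ ∑ i, ∑ j, M i j * (x i * x j) :=
    Finset.sum_le_sum fun i _ => Finset.sum_le_sum fun j _ => h1 i j
  simp only [Finset.sum_sub_distrib, Finset.sum_ite_eq, mem_univ, if_true] at h5
  rw [← Finset.mul_sum] at h5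
  rw [← Finset.sum_div] at h3 h4
  linarith

/-- Discrete maximum principle for diagonally dominant matrices. -/
lemma IsDominant.abs_le {δ : ℝ} (hδ : 0 < δ) {M : Matrix ι ι ℝ} (hM : IsDominant δ M)
    {d : ι → ℝ} {a b : ℝ} (ha : 0 ≤ a) (hb : 0 ≤ b)
    (h : ∀ j, |d j| ≤ a ∨ |∑ k, M j k * d k| ≤ b) (j : ι) : |d j| ≤ a + b / δ := by
  -- At an index where `|d|` is maximal, the off-diagonal part of the row is at most `(1 - δ)|d m|`,
  -- so a bound on `M d` there leaves `δ |d m| ≤ b`.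
  obtain ⟨m, -, hm⟩ := Finset.exists_max_image univ (fun j => |d j|) ⟨j, mem_univ j⟩
  refine (hm j (mem_univ j)).trans ?_
  have hbδ : 0 ≤ b / δ := by positivity
  rcases h m with h | h
  · linarith
  · rw [← Finset.add_sum_erase _ _ (mem_univ m), hM.diag, one_mul] at h
    have h1 : |∑ k ∈ univ.erase m, M m k * d k| ≤ (1 - δ) * |d m| := by
      refine (Finset.abs_sum_le_sum_abs _ _).trans ?_
      refine le_trans (Finset.sum_le_sum fun k _ => ?_)
        (le_trans (le_of_eq (Finset.sum_mul _ _ _).symm)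
          (mul_le_mul_of_nonneg_right (hM.row_erase m) (abs_nonneg _)))
      rw [abs_mul]
      exact mul_le_mul_of_nonneg_left (hm k (mem_univ k)) (abs_nonneg _)
    have h2 : |d m| ≤ b + (1 - δ) * |d m| := by
      have := abs_sub (d m + ∑ k ∈ univ.erase m, M m k * d k) (∑ k ∈ univ.erase m, M m k * d k)
      rw [add_sub_cancel_right] at this
      linarith
    have h3 : |d m| ≤ b / δ := by
      rw [le_div_iff₀ hδ]
      linarith
    linarith

/-! ### Derivatives of the energy -/

lemma hasDerivAt_energy {K : ℝ} {ψb : ℝ → ℝ} (hψ : IsBoundedBy K ψb) {M : Matrix ι ι ℝ}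
    (hM : ∀ i j, M i j = M j i) (s x : ι → ℝ) (i : ι) (t : ℝ) :
    HasDerivAt (fun t => energy ψb M s (update x i t)) (grad ψb M s i (update x i t)) t := by
  have hx : ∀ j, HasDerivAt (fun t => update x i t j) ((Pi.single i (1 : ℝ) : ι → ℝ) j) t :=
    fun j => hasDerivAt_pi.1 (hasDerivAt_update x i t) j
  have h1 : ∀ j, HasDerivAt (fun t => ψb (update x i t j) + s j * update x i t j)
      (deriv ψb (update x i t j) * (Pi.single i (1 : ℝ) : ι → ℝ) j
        + s j * (Pi.single i (1 : ℝ) : ι → ℝ) j) t :=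
    fun j => ((hψ.diff _).hasDerivAt.comp t (hx j)).add ((hx j).const_mul (s j))
  have h2 : ∀ j k, HasDerivAt (fun t => M j k * (update x i t j * update x i t k))
      (M j k * ((Pi.single i (1 : ℝ) : ι → ℝ) j * update x i t k
        + update x i t j * (Pi.single i (1 : ℝ) : ι → ℝ) k)) t :=
    fun j k => ((hx j).mul (hx k)).const_mul (M j k)
  have h3 := (HasDerivAt.fun_sum (u := univ) fun j _ => h1 j).add
    ((HasDerivAt.fun_sum (u := univ) fun j _ =>
      HasDerivAt.fun_sum (u := univ) fun k _ => h2 j k).const_mul (1 / 2 : ℝ))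
  refine h3.congr_deriv ?_
  simp only [Finset.sum_add_distrib, mul_add, grad]
  have e1 : ∀ a : ι → ℝ, ∑ j, a j * (Pi.single i (1 : ℝ) : ι → ℝ) j = a i := by
    intro a; simp [Pi.single_apply]
  have e2 : ∑ j, ∑ k, M j k * ((Pi.single i (1 : ℝ) : ι → ℝ) j * update x i t k)
      = ∑ k, M i k * update x i t k := by
    rw [Finset.sum_comm]
    refine Finset.sum_congr rfl fun k _ => ?_
    rw [← e1 fun j => M j k * update x i t k]
    exact Finset.sum_congr rfl fun j _ => by ring
  have e3 : ∑ j, ∑ k, M j k * (update x i t j * (Pi.single i (1 : ℝ) : ι → ℝ) k)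
      = ∑ k, M i k * update x i t k := by
    refine Finset.sum_congr rfl fun j _ => ?_
    rw [hM i j, ← e1 fun k => M j k * update x i t j]
    exact Finset.sum_congr rfl fun j _ => by ring
  rw [e1, e1, e2, e3]
  ring

lemma hasDerivAt_grad {K : ℝ} {ψb : ℝ → ℝ} (hψ : IsBoundedBy K ψb) (M : Matrix ι ι ℝ)
    (s x : ι → ℝ) (k i : ι) (t : ℝ) :
    HasDerivAt (fun t => grad ψb M s k (update x i t))
      ((if k = i then deriv (deriv ψb) (update x i t k) else 0) + M k i) t := by
  have hx : ∀ j, HasDerivAt (fun t => update x i t j) ((Pi.single i (1 : ℝ) : ι → ℝ) j) t :=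
    fun j => hasDerivAt_pi.1 (hasDerivAt_update x i t) j
  have h3 := (((hψ.diff_deriv _).hasDerivAt.comp t (hx k)).add_const (s k)).add
    (HasDerivAt.fun_sum (u := univ) fun j _ => (hx j).const_mul (M k j))
  refine h3.congr_deriv ?_
  simp [Pi.single_apply]

lemma continuous_energy {K : ℝ} {ψb : ℝ → ℝ} (hψ : IsBoundedBy K ψb) (M : Matrix ι ι ℝ)
    (s : ι → ℝ) : Continuous (energy ψb M s) := by
  have := hψ.diff.continuous
  unfold energy
  fun_prop

/-! ### An algebra of functions integrable against every Gibbs weight -/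

/-- Measurable functions of at most exponential growth. -/
structure IsTame (F : (ι → ℝ) → ℝ) : Prop where
  measurable : Measurable F
  growth : ∃ C c : ℝ, 0 ≤ C ∧ 0 ≤ c ∧ ∀ x, |F x| ≤ C * Real.exp (c * ∑ i, |x i|)

lemma sum_abs_nonneg (x : ι → ℝ) : 0 ≤ ∑ i, |x i| := Finset.sum_nonneg fun _ _ => abs_nonneg _

namespace IsTame

variable {F G : (ι → ℝ) → ℝ}

lemma of_bounded (hF : Measurable F) {C : ℝ} (h : ∀ x, |F x| ≤ C) : IsTame F :=
  ⟨hF, |C|, 0, abs_nonneg _, le_rfl, fun x => by simpa using (h x).trans (le_abs_self C)⟩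

lemma const (c : ℝ) : IsTame fun _ : ι → ℝ => c :=
  of_bounded measurable_const fun _ => le_rfl

lemma add (hF : IsTame F) (hG : IsTame G) : IsTame fun x => F x + G x := by
  obtain ⟨C, c, hC, hc, h⟩ := hF.growth
  obtain ⟨D, d, hD, hd, h'⟩ := hG.growth
  refine ⟨hF.measurable.add hG.measurable, C + D, c + d, by positivity, by positivity, fun x => ?_⟩
  have hs := sum_abs_nonneg x
  have e1 : Real.exp (c * ∑ i, |x i|) ≤ Real.exp ((c + d) * ∑ i, |x i|) :=
    Real.exp_le_exp.2 (by nlinarith)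
  have e2 : Real.exp (d * ∑ i, |x i|) ≤ Real.exp ((c + d) * ∑ i, |x i|) :=
    Real.exp_le_exp.2 (by nlinarith)
  calc |F x + G x| ≤ |F x| + |G x| := abs_add_le _ _
    _ ≤ C * Real.exp (c * ∑ i, |x i|) + D * Real.exp (d * ∑ i, |x i|) := add_le_add (h x) (h' x)
    _ ≤ C * Real.exp ((c + d) * ∑ i, |x i|) + D * Real.exp ((c + d) * ∑ i, |x i|) :=
      add_le_add (mul_le_mul_of_nonneg_left e1 hC) (mul_le_mul_of_nonneg_left e2 hD)
    _ = _ := by ring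

lemma mul (hF : IsTame F) (hG : IsTame G) : IsTame fun x => F x * G x := by
  obtain ⟨C, c, hC, hc, h⟩ := hF.growth
  obtain ⟨D, d, hD, hd, h'⟩ := hG.growth
  refine ⟨hF.measurable.mul hG.measurable, C * D, c + d, by positivity, by positivity, fun x => ?_⟩
  rw [abs_mul, add_mul, Real.exp_add]
  calc |F x| * |G x| ≤ (C * Real.exp (c * ∑ i, |x i|)) * (D * Real.exp (d * ∑ i, |x i|)) :=
        mul_le_mul (h x) (h' x) (abs_nonneg _) (by positivity)
    _ = _ := by ring

lemma const_mul (hF : IsTame F) (c : ℝ) : IsTame fun x => c * F x := (const c).mul hF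

lemma sub (hF : IsTame F) (hG : IsTame G) : IsTame fun x => F x - G x := by
  simpa [sub_eq_add_neg] using hF.add (hG.const_mul (-1))

lemma sum {κ : Type*} (t : Finset κ) {f : κ → (ι → ℝ) → ℝ} (h : ∀ k ∈ t, IsTame (f k)) :
    IsTame fun x => ∑ k ∈ t, f k x := by
  classical
  induction t using Finset.induction_on with
  | empty => simpa using const (0 : ℝ)
  | insert a t ha ih =>
    simp only [Finset.sum_insert ha]
    exact (h a (Finset.mem_insert_self _ _)).add
      (ih fun k hk => h k (Finset.mem_insert_of_mem hk))

lemma coord (i : ι) : IsTame fun x : ι → ℝ => x i := by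
  refine ⟨measurable_pi_apply i, 1, 1, zero_le_one, zero_le_one, fun x => ?_⟩
  have h1 : |x i| ≤ ∑ j, |x j| :=
    Finset.single_le_sum (f := fun j => |x j|) (fun j _ => abs_nonneg _) (mem_univ i)
  have h2 := Real.add_one_le_exp (∑ j, |x j|)
  simp only [one_mul]
  linarith

end IsTame

lemma isTame_grad {K : ℝ} {ψb : ℝ → ℝ} (hψ : IsBoundedBy K ψb) (M : Matrix ι ι ℝ)
    (s : ι → ℝ) (i : ι) : IsTame (grad ψb M s i) := by
  have h1 : IsTame fun x : ι → ℝ => deriv ψb (x i) :=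
    .of_bounded ((measurable_deriv ψb).comp (measurable_pi_apply i)) fun x => hψ.bound_deriv _
  exact (h1.add (.const (s i))).add (.sum _ fun j _ => (IsTame.coord j).const_mul (M i j))

/-! ### Reference measures with frozen coordinates -/

/-- Lebesgue measure in the coordinates of `A`, the other coordinates being frozen at `x`. -/
def base (A : Finset ι) (x : ι → ℝ) : Measure (ι → ℝ) :=
  Measure.pi fun i => if i ∈ A then volume else Measure.dirac (x i)

instance sigmaFinite_site (A : Finset ι) (x : ι → ℝ) (i : ι) :
    SigmaFinite (if i ∈ A then volume else Measure.dirac (x i) : Measure ℝ) := by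
  split_ifs <;> infer_instance

instance (A : Finset ι) (x : ι → ℝ) : SigmaFinite (base A x) := by
  unfold base; infer_instance

instance (A : Finset ι) (x : ι → ℝ) : NeZero (base A x) := by
  constructor
  intro h
  have h1 : base A x Set.univ = 0 := by rw [h]; simp
  rw [base, Measure.pi_univ, Finset.prod_eq_zero_iff] at h1
  obtain ⟨i, -, hi⟩ := h1
  split_ifs at hi <;> simp at hi

lemma base_univ (x : ι → ℝ) : base univ x = volume := by
  simp [base, volume_pi]

lemma measurable_piecewise (A : Finset ι) :
    Measurable fun p : (ι → ℝ) × (ι → ℝ) => A.piecewise p.2 p.1 := by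
  refine measurable_pi_lambda _ fun i => ?_
  by_cases hi : i ∈ A
  · simpa [hi, comp_def] using (measurable_pi_apply i).comp measurable_snd
  · simpa [hi, comp_def] using (measurable_pi_apply i).comp measurable_fst

lemma measurable_piecewise_left (A : Finset ι) (x : ι → ℝ) :
    Measurable fun z : ι → ℝ => A.piecewise z x :=
  (measurable_piecewise A).comp (measurable_const.prodMk measurable_id)

/-- Fubini for frozen coordinates. The point `x'` is arbitrary because only the `B`-coordinates of
the second sample are used. -/
lemma base_union {A B : Finset ι} (hAB : Disjoint A B) (x x' : ι → ℝ) :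
    base (A ∪ B) x
      = ((base A x).prod (base B x')).map fun p => B.piecewise p.2 p.1 := by
  refine Measure.pi_eq fun s hs => ?_
  rw [Measure.map_apply (measurable_piecewise B) (MeasurableSet.univ_pi hs)]
  have h1 : (fun p : (ι → ℝ) × (ι → ℝ) => B.piecewise p.2 p.1) ⁻¹' Set.univ.pi s
      = (Set.univ.pi fun i => if i ∈ B then Set.univ else s i) ×ˢ
        (Set.univ.pi fun i => if i ∈ B then s i else Set.univ) := by
    ext p
    simp only [Set.mem_preimage, Set.mem_univ_pi, Set.mem_prod, ← forall_and]
    refine forall_congr' fun i => ?_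
    by_cases hi : i ∈ B <;> simp [hi]
  rw [h1, Measure.prod_prod, base, base, Measure.pi_pi, Measure.pi_pi, ← Finset.prod_mul_distrib]
  refine Finset.prod_congr rfl fun i _ => ?_
  by_cases hi : i ∈ B
  · have hA : i ∉ A := fun h => Finset.disjoint_left.1 hAB h hi
    simp [hi, hA]
  · simp [hi]

/-- Only the free coordinates of a sample carry information, so the frozen values can be reinserted
by hand. This moves the dependence on `x` from the measure to the integrand, as needed for
measurability and differentiation in `x`. -/
lemma base_eq_map (A : Finset ι) (x x' : ι → ℝ) :
    base A x = (base A x').map fun z => A.piecewise z x := by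
  refine Measure.pi_eq fun s hs => ?_
  rw [Measure.map_apply (measurable_piecewise_left A x) (MeasurableSet.univ_pi hs)]
  have h1 : (fun z : ι → ℝ => A.piecewise z x) ⁻¹' Set.univ.pi s
      = Set.univ.pi fun i => if i ∈ A then s i else {_z | x i ∈ s i} := by
    ext p
    simp only [Set.mem_preimage, Set.mem_univ_pi]
    refine forall_congr' fun i => ?_
    by_cases hi : i ∈ A <;> simp [hi]
  rw [h1, base, Measure.pi_pi]
  refine Finset.prod_congr rfl fun i _ => ?_
  by_cases hi : i ∈ A
  · simp [hi]
  · by_cases h : x i ∈ s i <;> simp [hi, h, Measure.dirac_apply' _ (hs i)]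

lemma ae_base (A : Finset ι) (x : ι → ℝ) : ∀ᵐ y ∂base A x, ∀ i ∉ A, y i = x i := by
  rw [base_eq_map A x x, ae_map_iff (measurable_piecewise_left A x).aemeasurable]
  · exact Filter.Eventually.of_forall fun z i hi => by simp [hi]
  · simp only [Set.ofPred_forall]
    exact MeasurableSet.iInter fun i => MeasurableSet.iInter fun _ =>
      measurableSet_eq_fun (measurable_pi_apply i) measurable_const

lemma integral_base (A : Finset ι) (x x' : ι → ℝ) {F : (ι → ℝ) → ℝ} (hF : Measurable F) :
    ∫ y, F y ∂base A x = ∫ z, F (A.piecewise z x) ∂base A x' := by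
  rw [base_eq_map A x x', integral_map (measurable_piecewise_left A x).aemeasurable
    hF.aestronglyMeasurable]

lemma integral_base_union {A B : Finset ι} (hAB : Disjoint A B) (x : ι → ℝ)
    {F : (ι → ℝ) → ℝ} (hFm : Measurable F) (hF : Integrable F (base (A ∪ B) x)) :
    ∫ y, F y ∂base (A ∪ B) x = ∫ y, ∫ z, F z ∂base B y ∂base A x := by
  have hm := measurable_piecewise B
  rw [base_union hAB x x] at hF ⊢
  rw [integral_map hm.aemeasurable hFm.aestronglyMeasurable, integral_prod]
  · refine integral_congr_ae (Filter.Eventually.of_forall fun y => ?_)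
    simp only
    rw [integral_base B y x hFm]
  · exact (integrable_map_measure hFm.aestronglyMeasurable hm.aemeasurable).1 hF

/-! ### Conditional Gibbs measures -/

/-- A spin system: single-site perturbation, interaction matrix and external field. -/
structure Model (ι : Type*) [Fintype ι] where
  ψb : ℝ → ℝ
  K : ℝ
  δ : ℝ
  M : Matrix ι ι ℝ
  s : ι → ℝ
  δ_pos : 0 < δ
  bounded : IsBoundedBy K ψb
  dominant : IsDominant δ M

namespace Model

variable (m : Model ι)

lemma K_nonneg : 0 ≤ m.K := (abs_nonneg _).trans (m.bounded.bound 0)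

/-- The energy of the model. -/
def H (x : ι → ℝ) : ℝ := energy m.ψb m.M m.s x

/-- The partial derivatives of the energy of the model. -/
def dH (i : ι) (x : ι → ℝ) : ℝ := grad m.ψb m.M m.s i x

/-- The Boltzmann weight. -/
def w (x : ι → ℝ) : ℝ := Real.exp (-m.H x)

lemma w_pos (x : ι → ℝ) : 0 < m.w x := Real.exp_pos _

lemma measurable_H : Measurable m.H := (continuous_energy m.bounded m.M m.s).measurable

lemma measurable_w : Measurable m.w := m.measurable_H.neg.exp

lemma isTame_dH (i : ι) : IsTame (m.dH i) := isTame_grad m.bounded m.M m.s i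

lemma hasDerivAt_w (x : ι → ℝ) (i : ι) (t : ℝ) :
    HasDerivAt (fun t => m.w (update x i t)) (-(m.dH i (update x i t) * m.w (update x i t))) t := by
  have := (hasDerivAt_energy m.bounded m.dominant.symm m.s x i t).neg.exp
  refine this.congr_deriv ?_
  simp only [w, dH, H, Pi.neg_apply]
  ring

lemma H_ge (x : ι → ℝ) : ∑ i, (m.δ / 2 * x i ^ 2 - |m.s i| * |x i| - m.K) ≤ m.H x := by
  have h1 := m.dominant.quadratic_ge x
  have h2 : ∑ i, (- |m.s i| * |x i| - m.K) ≤ ∑ i, (m.ψb (x i) + m.s i * x i) := by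
    refine Finset.sum_le_sum fun i _ => ?_
    have h3 := neg_abs_le (m.ψb (x i))
    have h4 := m.bounded.bound (x i)
    have h5 := neg_abs_le (m.s i * x i)
    rw [abs_mul] at h5
    linarith
  unfold H energy
  simp only [Finset.sum_sub_distrib, ← Finset.mul_sum, neg_mul, Finset.sum_neg_distrib] at h2 ⊢
  linarith

lemma integrable_exp_quadratic {a : ℝ} (ha : 0 < a) (b c : ℝ) :
    Integrable fun t : ℝ => Real.exp (b * |t| - a * t ^ 2 + c) := by
  have h := ((integrable_exp_neg_mul_sq (half_pos ha)).const_mul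
    (Real.exp (b ^ 2 / (2 * a) + c)))
  refine h.mono' (by fun_prop) (Filter.Eventually.of_forall fun t => ?_)
  rw [Real.norm_eq_abs, Real.abs_exp, ← Real.exp_add]
  refine Real.exp_le_exp.2 ?_
  have h1 : b * |t| ≤ b ^ 2 / (2 * a) + a / 2 * t ^ 2 := by
    have h2 : b ^ 2 / (2 * a) + a / 2 * t ^ 2 - b * |t| = (b - a * |t|) ^ 2 / (2 * a) := by
      have := sq_abs t
      field_simp
      rw [← this]
      ring
    have h3 : 0 ≤ (b - a * |t|) ^ 2 / (2 * a) := by positivity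
    linarith
  linarith

/-- Exponent of a Gaussian bound for `exp (c * ∑ i, |y i|)` times the Boltzmann weight. -/
def envelope (c : ℝ) (y : ι → ℝ) : ℝ :=
  ∑ i, ((c + |m.s i|) * |y i| - m.δ / 2 * y i ^ 2 + m.K)

lemma integrable_exp_envelope (c : ℝ) (A : Finset ι) (x : ι → ℝ) :
    Integrable (fun y => Real.exp (m.envelope c y)) (base A x) := by
  have h1 : ∀ i, Integrable (fun t : ℝ =>
      Real.exp ((c + |m.s i|) * |t| - m.δ / 2 * t ^ 2 + m.K))
      (if i ∈ A then volume else Measure.dirac (x i)) := by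
    intro i
    split_ifs
    · exact integrable_exp_quadratic (half_pos m.δ_pos) _ _
    · exact integrable_dirac (by simp)
  simp only [envelope, Real.exp_sum]
  exact Integrable.fintype_prod h1

lemma exp_mul_w_le (c : ℝ) (y : ι → ℝ) :
    Real.exp (c * ∑ i, |y i|) * m.w y ≤ Real.exp (m.envelope c y) := by
  rw [w, ← Real.exp_add]
  refine Real.exp_le_exp.2 ?_
  have h2 := m.H_ge y
  have h3 : m.envelope c y
      = c * ∑ i, |y i| - ∑ i, (m.δ / 2 * y i ^ 2 - |m.s i| * |y i| - m.K) := by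
    rw [envelope, Finset.mul_sum, ← Finset.sum_sub_distrib]
    exact Finset.sum_congr rfl fun i _ => by ring
  linarith

lemma abs_mul_w_le {F : (ι → ℝ) → ℝ} {C c : ℝ} (hC : 0 ≤ C)
    (h : ∀ x, |F x| ≤ C * Real.exp (c * ∑ i, |x i|)) (y : ι → ℝ) :
    |F y * m.w y| ≤ C * Real.exp (m.envelope c y) := by
  rw [abs_mul, abs_of_pos (m.w_pos y)]
  refine (mul_le_mul_of_nonneg_right (h y) (m.w_pos y).le).trans ?_
  rw [mul_assoc]
  exact mul_le_mul_of_nonneg_left (m.exp_mul_w_le c y) hC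

lemma integrable_mul_w {F : (ι → ℝ) → ℝ} (hF : IsTame F) (A : Finset ι) (x : ι → ℝ) :
    Integrable (fun y => F y * m.w y) (base A x) := by
  obtain ⟨C, c, hC, -, h⟩ := hF.growth
  exact ((m.integrable_exp_envelope c A x).const_mul C).mono'
    (hF.measurable.mul m.measurable_w).aestronglyMeasurable
    (Filter.Eventually.of_forall (m.abs_mul_w_le hC h))

lemma integrable_w (A : Finset ι) (x : ι → ℝ) : Integrable m.w (base A x) := by
  simpa using m.integrable_mul_w (IsTame.const 1) A x

/-- The Gibbs measure in the coordinates of `A`, the other coordinates being frozen at `x`. -/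
def gibbs (A : Finset ι) (x : ι → ℝ) : Measure (ι → ℝ) :=
  (base A x).tilted fun y => -m.H y

instance (A : Finset ι) (x : ι → ℝ) : IsProbabilityMeasure (m.gibbs A x) :=
  isProbabilityMeasure_tilted (m.integrable_w A x)

/-- The partition function of the Gibbs measure. -/
def Z (A : Finset ι) (x : ι → ℝ) : ℝ := ∫ y, m.w y ∂base A x

lemma Z_pos (A : Finset ι) (x : ι → ℝ) : 0 < m.Z A x := integral_exp_pos (m.integrable_w A x)

lemma integral_gibbs (A : Finset ι) (x : ι → ℝ) (F : (ι → ℝ) → ℝ) :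
    ∫ y, F y ∂m.gibbs A x = (∫ y, F y * m.w y ∂base A x) / m.Z A x := by
  rw [gibbs, integral_tilted, ← integral_div]
  refine integral_congr_ae (Filter.Eventually.of_forall fun y => ?_)
  simp only [smul_eq_mul, Z, w]
  ring

lemma integral_mul_w (A : Finset ι) (x : ι → ℝ) (F : (ι → ℝ) → ℝ) :
    ∫ y, F y * m.w y ∂base A x = m.Z A x * ∫ y, F y ∂m.gibbs A x := by
  rw [integral_gibbs, mul_div_cancel₀ _ (m.Z_pos A x).ne']

lemma integrable_gibbs {F : (ι → ℝ) → ℝ} (hF : IsTame F) (A : Finset ι) (x : ι → ℝ) :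
    Integrable F (m.gibbs A x) := by
  rw [gibbs, integrable_tilted_iff (m.integrable_w A x)]
  refine (m.integrable_mul_w hF A x).congr (Filter.Eventually.of_forall fun y => ?_)
  simp only [smul_eq_mul, w]
  ring

lemma memLp_gibbs {F : (ι → ℝ) → ℝ} (hF : IsTame F) (A : Finset ι) (x : ι → ℝ) :
    MemLp F 2 (m.gibbs A x) := by
  rw [memLp_two_iff_integrable_sq hF.measurable.aestronglyMeasurable]
  simpa [sq] using m.integrable_gibbs (hF.mul hF) A x

lemma ae_gibbs (A : Finset ι) (x : ι → ℝ) : ∀ᵐ y ∂m.gibbs A x, ∀ i ∉ A, y i = x i :=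
  (tilted_absolutelyContinuous _ _).ae_le (ae_base A x)

/-- Functions of the frozen coordinates are almost surely constant. -/
lemma ae_eq_of_dependsOn {A : Finset ι} {u : (ι → ℝ) → ℝ} (hu : DependsOn u (Aᶜ : Set ι))
    (x : ι → ℝ) : ∀ᵐ y ∂m.gibbs A x, u y = u x := by
  filter_upwards [m.ae_gibbs A x] with y hy
  exact hu fun i hi => hy i (by simpa using hi)

lemma base_congr {A : Finset ι} {x x' : ι → ℝ} (h : ∀ i ∉ A, x i = x' i) :
    base A x = base A x' := by
  unfold base
  congr 1
  ext1 i
  split_ifs with hi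
  · rfl
  · rw [h i hi]

lemma dependsOn_gibbs (A : Finset ι) (F : (ι → ℝ) → ℝ) :
    DependsOn (fun x => ∫ y, F y ∂m.gibbs A x) (Aᶜ : Set ι) := by
  intro x x' h
  simp only [gibbs]
  rw [base_congr (A := A) (x := x) (x' := x') fun i hi => h i (by simpa using hi)]

lemma measurable_integral_base (A : Finset ι) {F : (ι → ℝ) → ℝ} (hF : Measurable F) :
    Measurable fun x => ∫ y, F y ∂base A x := by
  have h : (fun x => ∫ y, F y ∂base A x) = fun x => ∫ z, F (A.piecewise z x) ∂base A 0 := by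
    ext x
    exact integral_base A x 0 hF
  rw [h]
  exact ((hF.comp (measurable_piecewise A)).stronglyMeasurable.integral_prod_right').measurable

lemma measurable_integral_gibbs (A : Finset ι) {F : (ι → ℝ) → ℝ} (hF : Measurable F) :
    Measurable fun x => ∫ y, F y ∂m.gibbs A x := by
  simp only [integral_gibbs, Z]
  exact (measurable_integral_base A (hF.mul m.measurable_w)).div
    (measurable_integral_base A m.measurable_w)

lemma abs_integral_gibbs_le {A : Finset ι} {F : (ι → ℝ) → ℝ} {C : ℝ} (h : ∀ x, |F x| ≤ C)
    (x : ι → ℝ) : |∫ y, F y ∂m.gibbs A x| ≤ C := by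
  have := norm_integral_le_of_norm_le_const (μ := m.gibbs A x) (f := F) (C := C)
    (Filter.Eventually.of_forall h)
  simpa using this

/-- The tower property of conditional Gibbs measures. -/
lemma tower {A B : Finset ι} (hBA : B ⊆ A) {F : (ι → ℝ) → ℝ} (hF : Measurable F) {C : ℝ}
    (hC : ∀ x, |F x| ≤ C) (x : ι → ℝ) :
    ∫ y, ∫ z, F z ∂m.gibbs B y ∂m.gibbs A x = ∫ y, F y ∂m.gibbs A x := by
  have hd : Disjoint (A \ B) B := Finset.sdiff_disjoint
  have hu : A \ B ∪ B = A := Finset.sdiff_union_of_subset hBA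
  have hG := m.measurable_integral_gibbs B hF
  have hGt : IsTame fun y => ∫ z, F z ∂m.gibbs B y :=
    .of_bounded hG (m.abs_integral_gibbs_le hC)
  rw [m.integral_gibbs A x, m.integral_gibbs A x]
  congr 1
  have e1 := integral_base_union hd x (hG.mul m.measurable_w)
    (by rw [hu]; exact m.integrable_mul_w hGt A x)
  have e2 := integral_base_union hd x (hF.mul m.measurable_w)
    (by rw [hu]; exact m.integrable_mul_w (.of_bounded hF hC) A x)
  rw [hu] at e1 e2
  simp only [Pi.mul_apply] at e1 e2
  rw [e1, e2]
  refine integral_congr_ae (Filter.Eventually.of_forall fun y => ?_)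
  -- After freezing the coordinates outside `B`, both inner integrals equal `Z B y` times a Gibbs
  -- mean. The conditional mean is almost surely constant there, so averaging it again changes
  -- nothing.
  simp only
  rw [m.integral_mul_w B y, m.integral_mul_w B y]
  congr 1
  rw [integral_congr_ae (m.ae_eq_of_dependsOn (m.dependsOn_gibbs B F) y)]
  simp

end Model

/-! ### Covariance inequalities -/

section Covariance

variable {Ω : Type*} [MeasurableSpace Ω] {μ : Measure Ω}

/-- The quadratic polynomial `a ↦ Var(a X + Y)` is nonnegative, so its discriminant is nonpositive.
-/
lemma covariance_sq_le [IsProbabilityMeasure μ] {X Y : Ω → ℝ} (hX : MemLp X 2 μ)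
    (hY : MemLp Y 2 μ) : cov[X, Y; μ] ^ 2 ≤ Var[X; μ] * Var[Y; μ] := by
  have h : ∀ a : ℝ, 0 ≤ Var[X; μ] * (a * a) + 2 * cov[X, Y; μ] * a + Var[Y; μ] := by
    intro a
    have h1 := variance_nonneg (fun ω => a * X ω + Y ω) μ
    rw [variance_fun_add (hX.const_mul a) hY, variance_const_mul, covariance_const_mul_left] at h1
    linarith
  have := discrim_le_zero h
  rw [discrim] at this
  linarith

lemma abs_covariance_le [IsProbabilityMeasure μ] {X Y : Ω → ℝ} (hX : MemLp X 2 μ)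
    (hY : MemLp Y 2 μ) : |cov[X, Y; μ]| ≤ √Var[X; μ] * √Var[Y; μ] := by
  rw [← Real.sqrt_mul (variance_nonneg _ _), ← Real.sqrt_sq_eq_abs]
  exact Real.sqrt_le_sqrt (covariance_sq_le hX hY)

/-- The standard deviation satisfies the triangle inequality. -/
lemma sqrt_variance_add_le [IsProbabilityMeasure μ] {X Y : Ω → ℝ} (hX : MemLp X 2 μ)
    (hY : MemLp Y 2 μ) : √Var[fun ω => X ω + Y ω; μ] ≤ √Var[X; μ] + √Var[Y; μ] := by
  refine Real.sqrt_le_iff.2 ⟨by positivity, ?_⟩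
  rw [variance_fun_add hX hY]
  have h := (le_abs_self _).trans (abs_covariance_le hX hY)
  nlinarith [Real.sq_sqrt (variance_nonneg X μ), Real.sq_sqrt (variance_nonneg Y μ)]

lemma sqrt_variance_sum_le [IsProbabilityMeasure μ] {κ : Type*} (t : Finset κ)
    {X : κ → Ω → ℝ} (hX : ∀ k ∈ t, MemLp (X k) 2 μ) :
    √Var[fun ω => ∑ k ∈ t, X k ω; μ] ≤ ∑ k ∈ t, √Var[X k; μ] := by
  classical
  induction t using Finset.induction_on with
  | empty =>
    have : Var[fun _ : Ω => (0 : ℝ); μ] = 0 := variance_zero μ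
    simp [this]
  | insert a t ha ih =>
    simp only [Finset.sum_insert ha]
    have h1 := fun k hk => hX k (Finset.mem_insert_of_mem hk)
    refine (sqrt_variance_add_le (hX a (Finset.mem_insert_self _ _))
      (memLp_finsetSum t h1)).trans ?_
    linarith [ih h1]

lemma variance_le_integral_sub_sq [IsProbabilityMeasure μ] {X : Ω → ℝ} (hX : MemLp X 2 μ)
    (c : ℝ) : Var[X; μ] ≤ ∫ ω, (X ω - c) ^ 2 ∂μ := by
  rw [← variance_sub_const hX.aestronglyMeasurable c]
  exact variance_le_expectation_sq (hX.aestronglyMeasurable.sub aestronglyMeasurable_const)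

lemma variance_eq_zero_of_ae_eq_const [IsProbabilityMeasure μ] {X : Ω → ℝ} {c : ℝ}
    (h : ∀ᵐ ω ∂μ, X ω = c) : Var[X; μ] = 0 := by
  rw [variance_congr h]
  have h2 : Var[fun _ : Ω => c; μ] = Var[fun _ : Ω => (0 : ℝ) + c; μ] := by simp
  rw [h2, variance_add_const aestronglyMeasurable_const]
  exact variance_zero μ

end Covariance

/-! ### Slices along one coordinate -/

lemma base_singleton (i : ι) (y : ι → ℝ) : base {i} y = (volume : Measure ℝ).map (update y i) := by
  refine Measure.pi_eq fun s hs => ?_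
  rw [Measure.map_apply (measurable_update y) (MeasurableSet.univ_pi hs),
    ← Finset.mul_prod_erase _ _ (mem_univ i)]
  by_cases h : ∀ j, j ≠ i → y j ∈ s j
  · have h1 : update y i ⁻¹' Set.univ.pi s = s i := by
      ext t
      simp only [Set.mem_preimage, Set.mem_univ_pi]
      constructor
      · intro ht; simpa using ht i
      · intro ht j
        by_cases hj : j = i
        · subst hj; simpa using ht
        · simpa [hj] using h j hj
    rw [h1, Finset.prod_eq_one]
    · simp
    · intro j hj
      have hj' := Finset.ne_of_mem_erase hj
      simp [hj', Measure.dirac_apply' _ (hs j), h j hj']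
  · push Not at h
    obtain ⟨j, hj, hjs⟩ := h
    have h1 : update y i ⁻¹' Set.univ.pi s = ∅ := by
      ext t
      simp only [Set.mem_preimage, Set.mem_univ_pi, Set.mem_empty_iff_false, iff_false]
      intro ht
      exact hjs (by simpa [hj] using ht j)
    have h2 : ∏ j ∈ univ.erase i, (if j ∈ ({i} : Finset ι) then volume
        else Measure.dirac (y j) : Measure ℝ) (s j) = 0 :=
      Finset.prod_eq_zero (i := j) (by simp [hj])
        (by simp [hj, Measure.dirac_apply' _ (hs j), hjs])
    rw [h1, h2]
    simp

lemma integral_base_singleton (i : ι) (y : ι → ℝ) {F : (ι → ℝ) → ℝ} (hF : Measurable F) :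
    ∫ z, F z ∂base {i} y = ∫ t, F (update y i t) := by
  rw [base_singleton, integral_map (measurable_update y).aemeasurable hF.aestronglyMeasurable]

lemma integrable_base_singleton (i : ι) (y : ι → ℝ) {F : (ι → ℝ) → ℝ} (hF : Measurable F) :
    Integrable F (base {i} y) ↔ Integrable fun t => F (update y i t) := by
  rw [base_singleton, integrable_map_measure hF.aestronglyMeasurable
    (measurable_update y).aemeasurable]
  rfl

lemma ae_integrable_base {A B : Finset ι} (hAB : Disjoint A B) (x : ι → ℝ)
    {F : (ι → ℝ) → ℝ} (hFm : Measurable F) (hF : Integrable F (base (A ∪ B) x)) :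
    ∀ᵐ y ∂base A x, Integrable F (base B y) := by
  have hm := measurable_piecewise B
  rw [base_union hAB x x] at hF
  filter_upwards [((integrable_map_measure hFm.aestronglyMeasurable hm.aemeasurable).1
    hF).prod_right_ae] with y hy
  rw [base_eq_map B y x, integrable_map_measure hFm.aestronglyMeasurable
    (measurable_piecewise_left B y).aemeasurable]
  exact hy

/-! ### Integration by parts, single-spin variances and the lower bound -/

/-- Bounds the variances of single spins in terms of `K` and `δ`. -/
def spinVarConst (K δ : ℝ) : ℝ := 2 / δ + (K / δ) ^ 2

namespace Model

variable (m : Model ι)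

/-- Integration by parts for conditional Gibbs measures. -/
lemma integral_deriv {A : Finset ι} {i : ι} (hi : i ∈ A) {F F' : (ι → ℝ) → ℝ} (hF : IsTame F)
    (hF' : IsTame F')
    (hd : ∀ x t, HasDerivAt (fun t => F (update x i t)) (F' (update x i t)) t) (x : ι → ℝ) :
    ∫ y, F' y ∂m.gibbs A x = ∫ y, F y * m.dH i y ∂m.gibbs A x := by
  have hFd := hF.mul (m.isTame_dH i)
  have hu : A.erase i ∪ {i} = A := by
    rw [Finset.union_comm]; exact Finset.insert_erase hi
  have hdis : Disjoint (A.erase i) {i} := by simp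
  rw [← sub_eq_zero, ← integral_sub (m.integrable_gibbs hF' A x) (m.integrable_gibbs hFd A x),
    integral_gibbs, div_eq_zero_iff]
  left
  have ht := hF'.sub hFd
  have hmeas : Measurable fun y => (F' y - F y * m.dH i y) * m.w y :=
    ht.measurable.mul m.measurable_w
  have hmeas' : Measurable fun y => F y * m.w y := hF.measurable.mul m.measurable_w
  have hFint := m.integrable_mul_w ht A x
  have hFint' := m.integrable_mul_w hF A x
  rw [← hu] at hFint hFint' ⊢
  rw [integral_base_union hdis x hmeas hFint]
  refine integral_eq_zero_of_ae ?_
  filter_upwards [ae_integrable_base hdis x hmeas hFint, ae_integrable_base hdis x hmeas' hFint']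
    with y h1 h2
  rw [integral_base_singleton i y hmeas]
  rw [integrable_base_singleton i y hmeas] at h1
  rw [integrable_base_singleton i y hmeas'] at h2
  -- On a line in direction `i` the integrand is the derivative of `F w`. Fubini makes both
  -- integrable on almost every line, so the integral of the derivative vanishes.
  refine integral_eq_zero_of_hasDerivAt_of_integrable (fun t => ?_) h1 h2
  refine ((hd y t).mul (m.hasDerivAt_w y i t)).congr_deriv ?_
  ring

lemma integral_dH {A : Finset ι} {i : ι} (hi : i ∈ A) (x : ι → ℝ) :
    ∫ y, m.dH i y ∂m.gibbs A x = 0 := by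
  have h := m.integral_deriv hi (IsTame.const 1) (IsTame.const 0)
    (fun x t => hasDerivAt_const t (1 : ℝ)) x
  simpa using h.symm

/-- Integration by parts as a covariance identity. -/
lemma covariance_dH {A : Finset ι} {i : ι} (hi : i ∈ A) {F F' : (ι → ℝ) → ℝ} (hF : IsTame F)
    (hF' : IsTame F')
    (hd : ∀ x t, HasDerivAt (fun t => F (update x i t)) (F' (update x i t)) t) (x : ι → ℝ) :
    cov[F, m.dH i; m.gibbs A x] = ∫ y, F' y ∂m.gibbs A x := by
  rw [covariance_eq_sub (m.memLp_gibbs hF A x) (m.memLp_gibbs (m.isTame_dH i) A x),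
    m.integral_dH hi, m.integral_deriv hi hF hF' hd]
  simp

lemma covariance_coord_dH {A : Finset ι} {i : ι} (hi : i ∈ A) (j : ι) (x : ι → ℝ) :
    cov[fun y => y j, m.dH i; m.gibbs A x] = if j = i then 1 else 0 := by
  rw [m.covariance_dH hi (IsTame.coord j) (IsTame.const (if j = i then 1 else 0)) _ x]
  · simp
  · intro x t
    have := hasDerivAt_pi.1 (hasDerivAt_update x i t) j
    simpa [Pi.single_apply] using this

lemma isTame_deriv (i : ι) : IsTame fun y : ι → ℝ => deriv m.ψb (y i) :=
  .of_bounded ((measurable_deriv m.ψb).comp (measurable_pi_apply i))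
    fun _ => m.bounded.bound_deriv _

lemma isTame_linear (a : ι → ℝ) : IsTame fun y : ι → ℝ => ∑ j, a j * y j :=
  .sum _ fun j _ => (IsTame.coord j).const_mul (a j)

lemma variance_deriv_le (A : Finset ι) (x : ι → ℝ) (i : ι) :
    Var[fun y => deriv m.ψb (y i); m.gibbs A x] ≤ m.K ^ 2 := by
  refine (variance_le_expectation_sq (m.isTame_deriv i).measurable.aestronglyMeasurable).trans ?_
  have h : ∀ y : ι → ℝ, deriv m.ψb (y i) ^ 2 ≤ m.K ^ 2 := fun y =>
    sq_le_sq' (abs_le.1 (m.bounded.bound_deriv _)).1 (abs_le.1 (m.bounded.bound_deriv _)).2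
  calc _ ≤ ∫ _, m.K ^ 2 ∂m.gibbs A x :=
        integral_mono (by simpa [sq] using
          m.integrable_gibbs ((m.isTame_deriv i).mul (m.isTame_deriv i)) A x)
          (integrable_const _) h
    _ = m.K ^ 2 := by simp

/-- Expanding the force turns integration by parts into a linear system with matrix `M` for the
covariances, to which the maximum principle applies. -/
lemma covariance_dH_right (A : Finset ι) (x : ι → ℝ) (i : ι) {F : (ι → ℝ) → ℝ} (hF : IsTame F) :
    cov[F, m.dH i; m.gibbs A x] = cov[F, fun y => deriv m.ψb (y i); m.gibbs A x]
      + ∑ j, m.M i j * cov[F, fun y => y j; m.gibbs A x] := by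
  have h1 := m.isTame_deriv i
  have h2 := h1.add (.const (m.s i))
  have e : m.dH i = (fun y => deriv m.ψb (y i) + m.s i) + fun y => ∑ j, m.M i j * y j := by
    ext y; rfl
  rw [e, covariance_add_right (m.memLp_gibbs hF A x) (m.memLp_gibbs h2 A x)
    (m.memLp_gibbs (isTame_linear (m.M i)) A x),
    covariance_add_const_right (m.integrable_gibbs h1 A x),
    covariance_fun_sum_right (fun j => m.memLp_gibbs ((IsTame.coord j).const_mul (m.M i j)) A x)
      (m.memLp_gibbs hF A x)]
  simp only [covariance_const_mul_right]

/-- The uniform bound on variances of single spins. -/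
def varBound : ℝ := spinVarConst m.K m.δ

lemma varBound_nonneg : 0 ≤ m.varBound := by
  have := m.δ_pos
  unfold varBound spinVarConst; positivity

/-- For fixed `j`, the vector of covariances of spin `j` with the other spins vanishes at frozen
sites. At free sites its image under `M` is bounded by `1 + √V K`, by integration by parts. The
maximum principle gives `V δ ≤ 1 + √V K`, which bounds `V` since the right side grows only like
`√V`. -/
lemma variance_coord_le (A : Finset ι) (x : ι → ℝ) (j : ι) :
    Var[fun y => y j; m.gibbs A x] ≤ m.varBound := by
  set V := Var[fun y => y j; m.gibbs A x] with hV
  have hV0 : 0 ≤ V := variance_nonneg _ _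
  have hj := m.memLp_gibbs (IsTame.coord j) A x
  have hδ := m.δ_pos
  have hK := m.K_nonneg
  have key : |cov[fun y => y j, fun y => y j; m.gibbs A x]| ≤ 0 + (1 + √V * m.K) / m.δ := by
    refine m.dominant.abs_le (d := fun k => cov[fun y => y j, fun y => y k; m.gibbs A x])
      (a := 0) (b := 1 + √V * m.K) hδ le_rfl (by positivity) (fun k => ?_) j
    by_cases hk : k ∈ A
    · right
      have h1 := m.covariance_coord_dH hk j x
      rw [m.covariance_dH_right A x k (IsTame.coord j)] at h1
      have h2 := abs_covariance_le hj (m.memLp_gibbs (m.isTame_deriv k) A x)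
      have h3 : √Var[fun y => deriv m.ψb (y k); m.gibbs A x] ≤ m.K :=
        Real.sqrt_le_iff.2 ⟨hK, m.variance_deriv_le A x k⟩
      have h4 := h2.trans (mul_le_mul_of_nonneg_left h3 (Real.sqrt_nonneg V))
      have h5 : ∑ l, m.M k l * cov[fun y => y j, fun y => y l; m.gibbs A x]
          = (if j = k then 1 else 0) - cov[fun y => y j, fun y => deriv m.ψb (y k); m.gibbs A x] :=
        by linarith
      rw [h5]
      refine (abs_sub _ _).trans (add_le_add ?_ h4)
      split_ifs <;> simp
    · left
      have h1 : Var[fun y => y k; m.gibbs A x] = 0 :=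
        variance_eq_zero_of_ae_eq_const ((m.ae_gibbs A x).mono fun y hy => hy k hk)
      have h2 := abs_covariance_le hj (m.memLp_gibbs (IsTame.coord k) A x)
      simpa [h1] using h2
  rw [covariance_self (measurable_pi_apply j).aemeasurable, ← hV, abs_of_nonneg hV0, zero_add,
    le_div_iff₀ hδ] at key
  have h6 : (√V) ^ 2 = V := Real.sq_sqrt hV0
  -- Young's inequality absorbs half of `V δ` from `√V K` into the left side; this is the origin of
  -- `spinVarConst`.
  have h7 : V * m.δ ≤ 2 + m.K ^ 2 / m.δ := by
    have h8 : √V * m.K ≤ V * m.δ / 2 + m.K ^ 2 / m.δ / 2 := by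
      have h9 : V * m.δ / 2 + m.K ^ 2 / m.δ / 2 - √V * m.K = (√V * m.δ - m.K) ^ 2 / (2 * m.δ) := by
        field_simp
        linear_combination (-m.δ ^ 2) * h6
      have h10 : 0 ≤ (√V * m.δ - m.K) ^ 2 / (2 * m.δ) := by positivity
      linarith
    linarith
  rw [← le_div_iff₀ hδ] at h7
  refine h7.trans (le_of_eq ?_)
  rw [varBound, spinVarConst]
  field_simp

lemma sum_abs_row_le (i : ι) : ∑ j, |m.M i j| ≤ 2 :=
  (m.dominant.row i).trans (by linarith [m.δ_pos])

/-- The force at a frozen site has bounded fluctuations. -/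
lemma variance_dH_le {A : Finset ι} {i : ι} (hi : i ∉ A) (x : ι → ℝ) :
    Var[m.dH i; m.gibbs A x] ≤ 4 * m.varBound := by
  have h1 := m.isTame_deriv i
  have e : Var[m.dH i; m.gibbs A x] = Var[fun y => ∑ j, m.M i j * y j; m.gibbs A x] := by
    have h2 : Var[fun y => deriv m.ψb (x i) + m.s i + ∑ j, m.M i j * y j; m.gibbs A x]
        = Var[fun y => ∑ j, m.M i j * y j; m.gibbs A x] :=
      variance_const_add (isTame_linear (m.M i)).measurable.aestronglyMeasurable _
    rw [← h2]
    refine variance_congr ?_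
    filter_upwards [m.ae_gibbs A x] with y hy
    simp [dH, grad, hy i hi]
  -- The factor 2 is the bound on absolute row sums of `M`; its square is the 4 in the statement.
  have h3 : √Var[fun y => ∑ j, m.M i j * y j; m.gibbs A x] ≤ 2 * √m.varBound := by
    refine (sqrt_variance_sum_le univ fun j _ =>
      m.memLp_gibbs ((IsTame.coord j).const_mul (m.M i j)) A x).trans ?_
    refine le_trans (Finset.sum_le_sum fun j _ => ?_) (le_trans
      (le_of_eq (Finset.sum_mul univ (fun j => |m.M i j|) (√m.varBound)).symm)
      (mul_le_mul_of_nonneg_right (m.sum_abs_row_le i) (Real.sqrt_nonneg _)))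
    rw [variance_const_mul, Real.sqrt_mul (sq_nonneg _), Real.sqrt_sq_eq_abs]
    exact mul_le_mul_of_nonneg_left (Real.sqrt_le_sqrt (m.variance_coord_le A x j)) (abs_nonneg _)
  rw [e, ← Real.sq_sqrt (variance_nonneg _ _)]
  calc _ ≤ (2 * √m.varBound) ^ 2 := pow_le_pow_left₀ (Real.sqrt_nonneg _) h3 2
    _ = 4 * m.varBound := by rw [mul_pow, Real.sq_sqrt m.varBound_nonneg]; norm_num

/-- Cramér–Rao lower bound for the variance of the total spin. -/
lemma card_le_variance_sum (x : ι → ℝ) :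
    (Fintype.card ι : ℝ) ≤ (2 + m.K) * Var[fun y => ∑ k, y k; m.gibbs univ x] := by
  set n : ℝ := (Fintype.card ι : ℝ) with hn
  have hn0 : 0 ≤ n := by positivity
  have hK := m.K_nonneg
  have hS : IsTame fun y : ι → ℝ => ∑ k, y k := .sum _ fun k _ => IsTame.coord k
  have hD : IsTame fun y => ∑ i, m.dH i y := .sum _ fun i _ => m.isTame_dH i
  have h1 : cov[fun y => ∑ k, y k, fun y => ∑ i, m.dH i y; m.gibbs univ x] = n := by
    rw [covariance_fun_sum_fun_sum (fun k => m.memLp_gibbs (IsTame.coord k) _ x)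
      (fun i => m.memLp_gibbs (m.isTame_dH i) _ x)]
    simp [m.covariance_coord_dH (mem_univ _), hn]
  have h2 : Var[fun y => ∑ i, m.dH i y; m.gibbs univ x] ≤ (2 + m.K) * n := by
    rw [variance_fun_sum (fun i => m.memLp_gibbs (m.isTame_dH i) _ x)]
    -- Integration by parts a second time: the covariance of two forces is the mean of the mixed
    -- second derivative of the energy.
    have h3 : ∀ i j, cov[m.dH i, m.dH j; m.gibbs univ x]
        ≤ (if i = j then m.K else 0) + |m.M i j| := by
      intro i j
      have ht : IsTame fun y : ι → ℝ =>
          (if i = j then deriv (deriv m.ψb) (y i) else 0) + m.M i j := by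
        refine IsTame.add ?_ (.const _)
        refine .of_bounded (C := m.K) ?_ fun y => ?_
        · split_ifs
          · exact (measurable_deriv _).comp (measurable_pi_apply i)
          · exact measurable_const
        · split_ifs
          · exact m.bounded.bound_deriv_deriv _
          · simpa using hK
      rw [m.covariance_dH (mem_univ j) (m.isTame_dH i) ht
        (fun x t => hasDerivAt_grad m.bounded m.M m.s x i j t) x]
      refine le_trans (integral_mono (m.integrable_gibbs ht _ x) (integrable_const
        ((if i = j then m.K else 0) + |m.M i j|)) fun y => ?_) (by simp)
      refine add_le_add ?_ (le_abs_self _)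
      split_ifs
      · exact (le_abs_self _).trans (m.bounded.bound_deriv_deriv _)
      · exact le_rfl
    calc _ ≤ ∑ i, ∑ j, ((if i = j then m.K else 0) + |m.M i j|) :=
          Finset.sum_le_sum fun i _ => Finset.sum_le_sum fun j _ => h3 i j
      _ ≤ ∑ _i : ι, (m.K + 2) := by
          refine Finset.sum_le_sum fun i _ => ?_
          rw [Finset.sum_add_distrib]
          simpa using m.sum_abs_row_le i
      _ = (2 + m.K) * n := by simp [hn]; ring
  have h4 := covariance_sq_le (m.memLp_gibbs hS univ x) (m.memLp_gibbs hD univ x)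
  rw [h1] at h4
  have h5 := h4.trans (mul_le_mul_of_nonneg_left h2 (variance_nonneg _ _))
  rcases hn0.eq_or_lt with h | h
  · rw [← h]
    exact mul_nonneg (by linarith) (variance_nonneg _ _)
  · refine le_of_mul_le_mul_right ?_ h
    calc n * n = n ^ 2 := by ring
      _ ≤ _ := h5
      _ = _ := by ring

end Model

/-! ### A Poincaré inequality on the line -/

/-- A positive integrable density whose logarithmic derivative `-V` is, up to a bounded error,
uniformly decreasing. -/
structure IsNearlyLogConcave (δ L : ℝ) (p V : ℝ → ℝ) : Prop where
  pos : ∀ t, 0 < p t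
  integrable : Integrable p
  hasDerivAt : ∀ t, HasDerivAt p (-(V t * p t)) t
  increment : ∀ t t', t ≤ t' → δ * (t' - t) - L ≤ V t' - V t

/-- Bounds the ratio of tails to densities for nearly log-concave densities. -/
def tailConst (δ L : ℝ) : ℝ := ∫ h : ℝ, Real.exp (L * |h| - δ / 2 * h ^ 2 + 0)

lemma tailConst_nonneg (δ L : ℝ) : 0 ≤ tailConst δ L :=
  integral_nonneg fun _ => (Real.exp_pos _).le

namespace IsNearlyLogConcave

variable {δ L : ℝ} {p V : ℝ → ℝ}

lemma continuous (hp : IsNearlyLogConcave δ L p V) : Continuous p :=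
  continuous_iff_continuousAt.2 fun t => (hp.hasDerivAt t).continuousAt

lemma reflect (hp : IsNearlyLogConcave δ L p V) :
    IsNearlyLogConcave δ L (fun t => p (-t)) fun t => -V (-t) where
  pos t := hp.pos _
  integrable := hp.integrable.comp_neg
  hasDerivAt t := by
    have := (hp.hasDerivAt (-t)).scomp t (hasDerivAt_neg t)
    refine this.congr_deriv ?_
    simp
  increment t t' h := by
    have := hp.increment (-t') (-t) (by linarith)
    linarith

lemma exists_eq_zero (hδ : 0 < δ) (hL : 0 ≤ L) (hp : IsNearlyLogConcave δ L p V) :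
    ∃ t₀, V t₀ = 0 := by
  -- Far enough out that the increment bound forces `V b > 0` and `V (-b) < 0`.
  set b := (L + |V 0| + 1) / δ with hb
  have hb0 : 0 ≤ b := by positivity
  have hδb : δ * b = L + |V 0| + 1 := by rw [hb]; field_simp
  have h1 := hp.increment 0 b hb0
  have h2 := hp.increment (-b) 0 (by linarith)
  have h3 := neg_abs_le (V 0)
  have h4 := le_abs_self (V 0)
  have hd : ∀ t, HasDerivAt (fun t => -Real.log (p t)) (V t) t := by
    intro t
    refine ((hp.hasDerivAt t).log (hp.pos t).ne').neg.congr_deriv ?_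
    have := (hp.pos t).ne'
    field_simp
  -- Continuity of `V` is not assumed, but `V` is the derivative of `-log p`, so Darboux's theorem
  -- replaces the intermediate value theorem.
  obtain ⟨t, -, ht⟩ := exists_hasDerivWithinAt_eq_of_gt_of_lt (f := fun t => -Real.log (p t))
    (f' := V) (a := -b) (b := b) (m := 0) (by linarith)
    (fun x _ => (hd x).hasDerivWithinAt) (by linarith) (by linarith)
  exact ⟨t, ht⟩

variable {t₀ : ℝ}

lemma le_mul_exp (hp : IsNearlyLogConcave δ L p V) (hδ : 0 < δ) (h₀ : V t₀ = 0) {t u : ℝ}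
    (ht : t₀ ≤ t) (hu : t ≤ u) :
    p u ≤ p t * Real.exp (L * |u - t| - δ / 2 * (u - t) ^ 2 + 0) := by
  -- The density divided by its Gaussian envelope. It decreases to the right of `t` because `V v ≥ δ
  -- (v - t₀) - L ≥ δ (v - t) - L`.
  set q : ℝ → ℝ := fun v => p v * Real.exp (δ / 2 * (v - t) ^ 2 - L * (v - t)) with hq
  have hd : ∀ v, HasDerivAt q
      ((δ * (v - t) - L - V v) * (p v * Real.exp (δ / 2 * (v - t) ^ 2 - L * (v - t)))) v := by
    intro v
    have h1 : HasDerivAt (fun v : ℝ => v - t) 1 v := (hasDerivAt_id v).sub_const t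
    have h2 := (((h1.pow 2).const_mul (δ / 2)).sub (h1.const_mul L)).exp
    refine ((hp.hasDerivAt v).mul h2).congr_deriv ?_
    simp only [Pi.sub_apply, Pi.pow_apply]
    ring
  have hanti : AntitoneOn q (Set.Ici t) := by
    refine antitoneOn_of_deriv_nonpos (convex_Ici t)
      (fun v _ => (hd v).continuousAt.continuousWithinAt)
      (fun v _ => (hd v).differentiableAt.differentiableWithinAt) fun v hv => ?_
    rw [interior_Ici, Set.mem_Ioi] at hv
    rw [(hd v).deriv]
    refine mul_nonpos_of_nonpos_of_nonneg ?_ (mul_nonneg (hp.pos v).le (Real.exp_pos _).le)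
    have h3 := hp.increment t₀ v (by linarith)
    rw [h₀] at h3
    have h4 : δ * (v - t) ≤ δ * (v - t₀) := mul_le_mul_of_nonneg_left (by linarith) hδ.le
    linarith
  have h5 := hanti (Set.mem_Ici.2 le_rfl) (Set.mem_Ici.2 hu) hu
  simp only [hq, sub_self] at h5
  rw [abs_of_nonneg (by linarith)]
  have h6 : p u = p u * Real.exp (δ / 2 * (u - t) ^ 2 - L * (u - t))
      * Real.exp (L * (u - t) - δ / 2 * (u - t) ^ 2 + 0) := by
    rw [mul_assoc, ← Real.exp_add]
    simp
  rw [h6]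
  refine mul_le_mul_of_nonneg_right (h5.trans (by simp)) (Real.exp_pos _).le

lemma tail_le (hp : IsNearlyLogConcave δ L p V) (hδ : 0 < δ) (h₀ : V t₀ = 0) {t : ℝ}
    (ht : t₀ ≤ t) : ∫ u in Set.Ioi t, p u ≤ tailConst δ L * p t := by
  -- The summand `0` in `tailConst` is the constant `c` of `integrable_exp_quadratic`.
  have hk := (Model.integrable_exp_quadratic (half_pos hδ) L 0).comp_sub_right t
  have hk' := hk.const_mul (p t)
  calc ∫ u in Set.Ioi t, p u
      ≤ ∫ u in Set.Ioi t, p t * Real.exp (L * |u - t| - δ / 2 * (u - t) ^ 2 + 0) :=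
        setIntegral_mono_on hp.integrable.integrableOn hk'.integrableOn measurableSet_Ioi
          fun u hu => hp.le_mul_exp hδ h₀ ht (le_of_lt hu)
    _ ≤ ∫ u, p t * Real.exp (L * |u - t| - δ / 2 * (u - t) ^ 2 + 0) :=
        setIntegral_le_integral hk' (Filter.Eventually.of_forall fun u =>
          mul_nonneg (hp.pos t).le (Real.exp_pos _).le)
    _ = tailConst δ L * p t := by
        rw [integral_const_mul, tailConst, mul_comm,
          integral_sub_right_eq_self (fun h => Real.exp (L * |h| - δ / 2 * h ^ 2 + 0)) t]

/-- Hardy's inequality on a half line. -/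
lemma hardy (hp : IsNearlyLogConcave δ L p V) (hδ : 0 < δ) (h₀ : V t₀ = 0)
    {f f' : ℝ → ℝ} (hf : ∀ t, HasDerivAt f (f' t) t) {B : ℝ} (hfB : ∀ t, |f t| ≤ B)
    (hfB' : ∀ t, |f' t| ≤ B) :
    ∫ t in Set.Ioi t₀, (f t - f t₀) ^ 2 * p t
      ≤ 4 * tailConst δ L ^ 2 * ∫ t in Set.Ioi t₀, f' t ^ 2 * p t := by
  set C := tailConst δ L with hC
  have hC0 : 0 ≤ C := tailConst_nonneg δ L
  have hB0 : 0 ≤ B := (abs_nonneg _).trans (hfB 0)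
  set T : ℝ → ℝ := fun t => ∫ u in Set.Ioi t, p u with hT
  set J := ∫ u in Set.Ioi t₀, p u with hJ
  have hTJ : T = fun t => J - ∫ u in t₀..t, p u := by
    ext t
    have := intervalIntegral.integral_interval_add_Ioi (a := t₀) (b := t)
      hp.integrable.integrableOn hp.integrable.integrableOn
    simp only [hT, hJ]
    linarith
  have hTd : ∀ t, HasDerivAt T (-p t) t := by
    intro t
    rw [hTJ]
    exact ((hp.continuous.integral_hasStrictDerivAt t₀ t).hasDerivAt).const_sub J
  have hT0 : ∀ t, 0 ≤ T t := fun t => integral_nonneg fun u => (hp.pos u).le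
  have hTle : ∀ t, t₀ ≤ t → T t ≤ C * p t := fun t ht => hp.tail_le hδ h₀ ht
  have hTc : Continuous T := continuous_iff_continuousAt.2 fun t => (hTd t).continuousAt
  have hTlim : Filter.Tendsto T Filter.atTop (nhds 0) := by
    rw [hTJ, show (0 : ℝ) = J - J by ring]
    exact tendsto_const_nhds.sub
      (intervalIntegral_tendsto_integral_Ioi t₀ hp.integrable.integrableOn Filter.tendsto_id)
  have hfc : Continuous f := continuous_iff_continuousAt.2 fun t => (hf t).continuousAt
  have hfm' : Measurable f' := by
    have : f' = deriv f := by ext t; exact ((hf t).deriv).symm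
    rw [this]; exact measurable_deriv f
  set g : ℝ → ℝ := fun t => f t - f t₀ with hg
  have hgB : ∀ t, |g t| ≤ 2 * B := fun t =>
    (abs_sub _ _).trans (by linarith [hfB t, hfB t₀])
  have hgd : ∀ t, HasDerivAt g (f' t) t := fun t => (hf t).sub_const _
  have hgc : Continuous g := hfc.sub continuous_const
  have hpI : ∀ {h : ℝ → ℝ} {D : ℝ}, Measurable h → (∀ t, |h t| ≤ D) →
      IntegrableOn (fun t => h t * p t) (Set.Ioi t₀) := fun {h D} hm hD =>
    (hp.integrable.bdd_mul hm.aestronglyMeasurable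
      (Filter.Eventually.of_forall hD)).integrableOn
  have i1 : IntegrableOn (fun t => g t ^ 2 * p t) (Set.Ioi t₀) :=
    hpI (D := (2 * B) ^ 2) (hgc.measurable.pow_const 2) fun t => by
      rw [abs_pow]; exact pow_le_pow_left₀ (abs_nonneg _) (hgB t) 2
  have i2 : IntegrableOn (fun t => f' t ^ 2 * p t) (Set.Ioi t₀) :=
    hpI (D := B ^ 2) (hfm'.pow_const 2) fun t => by
      rw [abs_pow]; exact pow_le_pow_left₀ (abs_nonneg _) (hfB' t) 2
  -- The tail satisfies `T ≤ C p`. The weights in Young's inequality are chosen so that half of `∫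
  -- g² p` can be absorbed later, which gives the constant `4 C²`.
  have hbound : ∀ t ∈ Set.Ioi t₀,
      |2 * g t * f' t * T t| ≤ 1 / 2 * (g t ^ 2 * p t) + 2 * C ^ 2 * (f' t ^ 2 * p t) := by
    intro t ht
    rw [abs_mul, abs_of_nonneg (hT0 t), abs_mul, abs_mul, abs_two]
    have h1 : 2 * |g t| * |f' t| * T t ≤ 2 * |g t| * |f' t| * (C * p t) :=
      mul_le_mul_of_nonneg_left (hTle t (le_of_lt ht)) (by positivity)
    have h2 : 2 * |g t| * |f' t| * C ≤ 1 / 2 * g t ^ 2 + 2 * C ^ 2 * f' t ^ 2 := by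
      rw [← sq_abs (g t), ← sq_abs (f' t)]
      nlinarith [sq_nonneg (|g t| - 2 * C * |f' t|)]
    have h3 := mul_le_mul_of_nonneg_right h2 (hp.pos t).le
    linarith
  have i3 : IntegrableOn (fun t => 2 * g t * f' t * T t) (Set.Ioi t₀) := by
    refine Integrable.mono' ((i1.const_mul (1 / 2)).add (i2.const_mul (2 * C ^ 2)))
      (((hgc.measurable.const_mul 2).mul hfm').mul hTc.measurable).aestronglyMeasurable ?_
    exact (ae_restrict_iff' measurableSet_Ioi).2 (Filter.Eventually.of_forall hbound)
  have hlim : Filter.Tendsto (fun t => g t ^ 2 * T t) Filter.atTop (nhds 0) := by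
    refine squeeze_zero (fun t => mul_nonneg (sq_nonneg _) (hT0 t))
      (fun t => mul_le_mul_of_nonneg_right ?_ (hT0 t))
      (by simpa using hTlim.const_mul ((2 * B) ^ 2))
    rw [← sq_abs (g t)]
    exact pow_le_pow_left₀ (abs_nonneg _) (hgB t) 2
  -- Integration by parts with `p = -T'`. The boundary terms vanish because `g t₀ = 0`, `g` is
  -- bounded and `T` tends to 0.
  have key := integral_Ioi_of_hasDerivAt_of_tendsto' (a := t₀) (m := 0)
    (f := fun t => g t ^ 2 * T t) (f' := fun t => 2 * g t * f' t * T t - g t ^ 2 * p t)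
    (fun t _ => by
      refine (((hgd t).pow 2).mul (hTd t)).congr_deriv ?_
      simp only [Pi.pow_apply]
      ring) (i3.sub i1) hlim
  rw [integral_sub i3 i1] at key
  have hg0 : g t₀ = 0 := by simp [hg]
  simp only [hg0] at key
  have h4 : ∫ t in Set.Ioi t₀, 2 * g t * f' t * T t
      ≤ ∫ t in Set.Ioi t₀, (1 / 2 * (g t ^ 2 * p t) + 2 * C ^ 2 * (f' t ^ 2 * p t)) :=
    setIntegral_mono_on i3 ((i1.const_mul (1 / 2)).add (i2.const_mul (2 * C ^ 2)))
      measurableSet_Ioi fun t ht => (le_abs_self _).trans (hbound t ht)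
  rw [integral_add (i1.const_mul _) (i2.const_mul _), integral_const_mul, integral_const_mul] at h4
  linarith

/-- Poincaré inequality for nearly log-concave densities on the line. -/
theorem poincare (hδ : 0 < δ) (hL : 0 ≤ L) (hp : IsNearlyLogConcave δ L p V)
    {f f' : ℝ → ℝ} (hf : ∀ t, HasDerivAt f (f' t) t) {B : ℝ} (hfB : ∀ t, |f t| ≤ B)
    (hfB' : ∀ t, |f' t| ≤ B) :
    ∃ c, ∫ t, (f t - c) ^ 2 * p t ≤ 4 * tailConst δ L ^ 2 * ∫ t, f' t ^ 2 * p t := by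
  obtain ⟨t₀, h₀⟩ := hp.exists_eq_zero hδ hL
  -- Centring at a critical point of the density rather than at the mean lets both half lines be
  -- treated by `hardy`, the left one after reflection.
  refine ⟨f t₀, ?_⟩
  have hr := hp.hardy hδ h₀ hf hfB hfB'
  have hl := hp.reflect.hardy (t₀ := -t₀) (f := fun t => f (-t)) (f' := fun t => -f' (-t)) hδ
    (by simp [h₀]) (fun t => by
      refine ((hf (-t)).scomp t (hasDerivAt_neg t)).congr_deriv ?_
      simp) (fun t => hfB _) (fun t => by rw [abs_neg]; exact hfB' _)
  simp only [neg_neg, neg_sq] at hl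
  rw [← integral_comp_neg_Iic t₀ (fun t => (f (-t) - f t₀) ^ 2 * p (-t)),
    ← integral_comp_neg_Iic t₀ (fun t => f' (-t) ^ 2 * p (-t))] at hl
  simp only [neg_neg] at hl
  have hfc : Continuous f := continuous_iff_continuousAt.2 fun t => (hf t).continuousAt
  have hfm' : Measurable f' := by
    have : f' = deriv f := by ext t; exact ((hf t).deriv).symm
    rw [this]; exact measurable_deriv f
  have i1 : Integrable fun t => (f t - f t₀) ^ 2 * p t :=
    hp.integrable.bdd_mul (c := (2 * B) ^ 2)
      ((hfc.measurable.sub_const _).pow_const 2).aestronglyMeasurable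
      (Filter.Eventually.of_forall fun t => by
        rw [Real.norm_eq_abs, abs_pow]
        exact pow_le_pow_left₀ (abs_nonneg _)
          ((abs_sub _ _).trans (by linarith [hfB t, hfB t₀])) 2)
  have i2 : Integrable fun t => f' t ^ 2 * p t :=
    hp.integrable.bdd_mul (c := B ^ 2) (hfm'.pow_const 2).aestronglyMeasurable
      (Filter.Eventually.of_forall fun t => by
        rw [Real.norm_eq_abs, abs_pow]
        exact pow_le_pow_left₀ (abs_nonneg _) (hfB' t) 2)
  rw [← intervalIntegral.integral_Iic_add_Ioi i1.integrableOn i1.integrableOn (b := t₀),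
    ← intervalIntegral.integral_Iic_add_Ioi i2.integrableOn i2.integrableOn (b := t₀), mul_add]
  exact add_le_add hl hr

end IsNearlyLogConcave

/-! ### Dependence of conditional expectations on one frozen spin -/

lemma integral_base_update {A : Finset ι} {i : ι} (hi : i ∉ A) (x : ι → ℝ) (t : ℝ)
    {F : (ι → ℝ) → ℝ} (hF : Measurable F) :
    ∫ y, F y ∂base A (update x i t) = ∫ y, F (update y i t) ∂base A x := by
  have hm : Measurable fun y : ι → ℝ => F (update y i t) := by
    refine hF.comp (measurable_pi_lambda _ fun j => ?_)
    by_cases hj : j = i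
    · subst hj; simp
    · simpa [hj] using measurable_pi_apply j
  rw [integral_base A (update x i t) x hF, integral_base A x x hm]
  refine integral_congr_ae (Filter.Eventually.of_forall fun z => ?_)
  simp only
  congr 1
  ext j
  by_cases hj : j = i
  · subst hj; simp [hi]
  · by_cases hA : j ∈ A <;> simp [hj, hA]

lemma integrable_integral_base {A B : Finset ι} (hAB : Disjoint A B) (x : ι → ℝ)
    {F : (ι → ℝ) → ℝ} (hFm : Measurable F) (hF : Integrable F (base (A ∪ B) x)) :
    Integrable (fun y => ∫ z, F z ∂base B y) (base A x) := by
  have hm := measurable_piecewise B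
  rw [base_union hAB x x] at hF
  refine ((integrable_map_measure hFm.aestronglyMeasurable hm.aemeasurable).1
    hF).integral_prod_left.congr (Filter.Eventually.of_forall fun y => ?_)
  simp only [comp_def]
  rw [integral_base B y x hFm]

/-- Bounds the reduction of variances by revealing one site in terms of `K` and `δ`. -/
def revealConst (K δ : ℝ) : ℝ := 1 + 16 * tailConst δ (2 * K / δ) ^ 2 * spinVarConst K δ

namespace Model

variable (m : Model ι)

/-- Since `g` does not see site `i`, only the weight depends on the frozen value, and
differentiation under the integral produces the force at `i`. -/
lemma hasDerivAt_integral_base {A : Finset ι} {i : ι} (hi : i ∉ A) {g : (ι → ℝ) → ℝ}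
    (hg : IsTame g) (hgi : DependsOn g ({i}ᶜ : Set ι)) (x : ι → ℝ) (t : ℝ) :
    HasDerivAt (fun t => ∫ y, g y * m.w y ∂base A (update x i t))
      (-∫ y, g y * m.dH i y * m.w y ∂base A (update x i t)) t := by
  have hgd := hg.mul (m.isTame_dH i)
  have hgt : ∀ y t, g (update y i t) = g y := fun y t => hgi fun j hj => by
    have : j ≠ i := by simpa using hj
    simp [this]
  have hup : ∀ t, Measurable fun y : ι → ℝ => update y i t := fun t => by
    refine measurable_pi_lambda _ fun j => ?_
    by_cases hj : j = i
    · subst hj; simp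
    · simpa [hj] using measurable_pi_apply j
  have hm1 : Measurable fun y => g y * m.w y := hg.measurable.mul m.measurable_w
  have hm2 : Measurable fun y => g y * m.dH i y * m.w y := hgd.measurable.mul m.measurable_w
  obtain ⟨C, c, hC, hc, hb⟩ := hgd.growth
  simp only [integral_base_update hi x _ hm1]
  rw [integral_base_update hi x _ hm2, ← integral_neg]
  -- Bounds the change of the envelope when `y i = x i` is replaced by any `u` with `|u| ≤ |t| + 1`;
  -- the favourable term `-δ/2 u²` is dropped.
  set D := (c + |m.s i|) * (|t| + 1) - ((c + |m.s i|) * |x i| - m.δ / 2 * x i ^ 2) with hD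
  refine (hasDerivAt_integral_of_dominated_loc_of_deriv_le (s := Metric.ball t 1)
    (bound := fun y => C * Real.exp D * Real.exp (m.envelope c y))
    (F := fun t y => g (update y i t) * m.w (update y i t))
    (F' := fun t y => -(g (update y i t) * m.dH i (update y i t) * m.w (update y i t)))
    (Metric.ball_mem_nhds t one_pos)
    (Filter.Eventually.of_forall fun u => (hm1.comp (hup u)).aestronglyMeasurable) ?_
    (hm2.comp (hup t)).neg.aestronglyMeasurable ?_
    ((m.integrable_exp_envelope c A x).const_mul _) ?_).2
  · have h1 := m.integrable_mul_w hg A (update x i t)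
    rw [base_eq_map A (update x i t) x, integrable_map_measure hm1.aestronglyMeasurable
      (measurable_piecewise_left A _).aemeasurable] at h1
    change Integrable ((fun y => g y * m.w y) ∘ fun y => update y i t) (base A x)
    rw [base_eq_map A x x, integrable_map_measure (hm1.comp (hup t)).aestronglyMeasurable
      (measurable_piecewise_left A _).aemeasurable]
    refine h1.congr (Filter.Eventually.of_forall fun z => ?_)
    have e : A.piecewise z (update x i t) = update (A.piecewise z x) i t := by
      ext j
      by_cases hj : j = i
      · subst hj; simp [hi]
      · by_cases hA : j ∈ A <;> simp [hj, hA]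
    simp only [comp_def, e]
  · filter_upwards [ae_base A x] with y hy u hu
    have h1 := m.abs_mul_w_le hC hb (update y i u)
    rw [norm_neg, Real.norm_eq_abs]
    refine h1.trans ?_
    rw [mul_assoc, ← Real.exp_add]
    refine mul_le_mul_of_nonneg_left (Real.exp_le_exp.2 ?_) hC
    have hu' : |u| ≤ |t| + 1 := by
      rw [Metric.mem_ball, Real.dist_eq] at hu
      have := abs_sub_abs_le_abs_sub u t
      linarith
    have h4 : (c + |m.s i|) * |u| ≤ (c + |m.s i|) * (|t| + 1) :=
      mul_le_mul_of_nonneg_left hu' (by positivity)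
    have h5 : 0 ≤ m.δ / 2 * u ^ 2 := by have := m.δ_pos; positivity
    simp only [envelope]
    rw [← Finset.add_sum_erase _ _ (mem_univ i), ← Finset.add_sum_erase _ _ (mem_univ i)]
    have h6 : ∑ j ∈ univ.erase i, ((c + |m.s j|) * |update y i u j|
        - m.δ / 2 * update y i u j ^ 2 + m.K)
        = ∑ j ∈ univ.erase i, ((c + |m.s j|) * |y j| - m.δ / 2 * y j ^ 2 + m.K) :=
      Finset.sum_congr rfl fun j hj => by simp [Finset.ne_of_mem_erase hj]
    rw [h6, update_self, hy i hi]
    linarith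
  · refine Filter.Eventually.of_forall fun y u _ => ?_
    simp only [hgt]
    exact ((m.hasDerivAt_w y i u).const_mul (g y)).congr_deriv (by ring)

lemma hasDerivAt_Z {A : Finset ι} {i : ι} (hi : i ∉ A) (x : ι → ℝ) (t : ℝ) :
    HasDerivAt (fun t => m.Z A (update x i t))
      (-((∫ y, m.dH i y ∂m.gibbs A (update x i t)) * m.Z A (update x i t))) t := by
  have h := m.hasDerivAt_integral_base hi (IsTame.const 1) (fun _ _ _ => rfl) x t
  simp only [one_mul] at h
  rw [m.integral_mul_w, mul_comm] at h
  exact h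

/-- Conditional expectations respond to the conditioning through a covariance. -/
lemma hasDerivAt_integral_gibbs {A : Finset ι} {i : ι} (hi : i ∉ A) {g : (ι → ℝ) → ℝ}
    (hg : IsTame g) (hgi : DependsOn g ({i}ᶜ : Set ι)) (x : ι → ℝ) (t : ℝ) :
    HasDerivAt (fun t => ∫ y, g y ∂m.gibbs A (update x i t))
      (-cov[g, m.dH i; m.gibbs A (update x i t)]) t := by
  have h1 := m.hasDerivAt_integral_base hi hg hgi x t
  have h2 := m.hasDerivAt_Z hi x t
  have hZ := (m.Z_pos A (update x i t)).ne'
  simp only [m.integral_gibbs A (update x i _) g]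
  refine (h1.div h2 hZ).congr_deriv ?_
  rw [covariance_eq_sub (m.memLp_gibbs hg _ _) (m.memLp_gibbs (m.isTame_dH i) _ _),
    m.integral_mul_w, m.integral_mul_w]
  simp only [Pi.mul_apply]
  field_simp
  ring

lemma integral_dH_eq (A : Finset ι) (x : ι → ℝ) (i : ι) :
    ∫ y, m.dH i y ∂m.gibbs A x = (∫ y, deriv m.ψb (y i) ∂m.gibbs A x) + m.s i
      + ∑ j, m.M i j * ∫ y, y j ∂m.gibbs A x := by
  have h1 := m.integrable_gibbs (m.isTame_deriv i) A x
  have h2 := m.integrable_gibbs ((m.isTame_deriv i).add (.const (m.s i))) A x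
  have h3 := m.integrable_gibbs (isTame_linear (m.M i)) A x
  simp only [dH, grad]
  rw [integral_add h2 h3, integral_add h1 (integrable_const _), integral_finsetSum]
  · simp [integral_const_mul]
  · exact fun j _ => m.integrable_gibbs ((IsTame.coord j).const_mul _) A x

lemma integral_coord_of_notMem {A : Finset ι} {k : ι} (hk : k ∉ A) (x : ι → ℝ) :
    ∫ y, y k ∂m.gibbs A x = x k := by
  rw [integral_congr_ae ((m.ae_gibbs A x).mono fun y hy => hy k hk)]
  simp

/-- The mean force at a frozen site grows linearly in the value at that site, up to a bounded
error. -/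
lemma force_increment {A : Finset ι} {i : ι} (hi : i ∉ A) (x : ι → ℝ) {t t' : ℝ} (ht : t ≤ t') :
    m.δ * (t' - t) - 2 * m.K / m.δ ≤ (∫ y, m.dH i y ∂m.gibbs A (update x i t'))
      - ∫ y, m.dH i y ∂m.gibbs A (update x i t) := by
  set d : ι → ℝ := fun k => (∫ y, y k ∂m.gibbs A (update x i t'))
    - ∫ y, y k ∂m.gibbs A (update x i t) with hd
  set e : ι → ℝ := fun k => (∫ y, deriv m.ψb (y k) ∂m.gibbs A (update x i t'))
    - ∫ y, deriv m.ψb (y k) ∂m.gibbs A (update x i t) with he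
  have hδ := m.δ_pos
  have hK := m.K_nonneg
  have heK : ∀ k, |e k| ≤ 2 * m.K := fun k => by
    have h1 := m.abs_integral_gibbs_le (A := A) (F := fun y => deriv m.ψb (y k))
      (fun y => m.bounded.bound_deriv _) (update x i t')
    have h2 := m.abs_integral_gibbs_le (A := A) (F := fun y => deriv m.ψb (y k))
      (fun y => m.bounded.bound_deriv _) (update x i t)
    exact (abs_sub _ _).trans (by linarith)
  have hforce : ∀ k, (∫ y, m.dH k y ∂m.gibbs A (update x i t'))
      - ∫ y, m.dH k y ∂m.gibbs A (update x i t) = e k + ∑ j, m.M k j * d j := by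
    intro k
    rw [m.integral_dH_eq, m.integral_dH_eq]
    simp only [hd, he, mul_sub, Finset.sum_sub_distrib]
    ring
  have hdi : d i = t' - t := by
    simp only [hd]
    rw [m.integral_coord_of_notMem hi, m.integral_coord_of_notMem hi]
    simp
  -- At free sites the mean force is zero for both boundary values, so `M d = -e` there. At frozen
  -- sites `d` vanishes except for `d i = t' - t`.
  have hdb : ∀ j, |d j| ≤ (t' - t) + 2 * m.K / m.δ := by
    refine m.dominant.abs_le hδ (by linarith) (by linarith) fun k => ?_
    by_cases hk : k ∈ A
    · right
      have h1 := hforce k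
      rw [m.integral_dH hk, m.integral_dH hk] at h1
      have h2 : ∑ j, m.M k j * d j = -e k := by linarith
      rw [h2, abs_neg]
      exact heK k
    · left
      by_cases hki : k = i
      · rw [hki, hdi, abs_of_nonneg (by linarith)]
      · have : d k = 0 := by
          simp only [hd]
          rw [m.integral_coord_of_notMem hk, m.integral_coord_of_notMem hk]
          simp [hki]
        rw [this, abs_zero]
        linarith
  rw [hforce i, ← Finset.add_sum_erase _ _ (mem_univ i), m.dominant.diag, hdi]
  have h3 : |∑ j ∈ univ.erase i, m.M i j * d j| ≤ (1 - m.δ) * ((t' - t) + 2 * m.K / m.δ) := by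
    refine (Finset.abs_sum_le_sum_abs _ _).trans ?_
    refine le_trans (Finset.sum_le_sum fun k _ => ?_)
      (le_trans (le_of_eq (Finset.sum_mul _ _ _).symm)
        (mul_le_mul_of_nonneg_right (m.dominant.row_erase i) ((abs_nonneg _).trans (hdb i))))
    rw [abs_mul]
    exact mul_le_mul_of_nonneg_left (hdb k) (abs_nonneg _)
  have h4 := neg_abs_le (∑ j ∈ univ.erase i, m.M i j * d j)
  have h5 := neg_abs_le (e i)
  have h6 := heK i
  -- The errors `2K` from `e i` and `(1 - δ) 2K/δ` from the other rows' response add up to exactly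
  -- `2K/δ`.
  have h7 : (1 - m.δ) * (2 * m.K / m.δ) = 2 * m.K / m.δ - 2 * m.K := by field_simp
  linarith

lemma insert_erase_union {A : Finset ι} {i : ι} (hi : i ∈ A) : {i} ∪ A.erase i = A :=
  Finset.insert_erase hi

/-- The law of a single spin is nearly log-concave. -/
lemma isNearlyLogConcave (A : Finset ι) (i : ι) (x : ι → ℝ) :
    IsNearlyLogConcave m.δ (2 * m.K / m.δ) (fun t => m.Z (A.erase i) (update x i t))
      fun t => ∫ y, m.dH i y ∂m.gibbs (A.erase i) (update x i t) where
  pos _ := m.Z_pos _ _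
  integrable := by
    have h := integrable_integral_base (A := {i}) (B := A.erase i) (by simp) x m.measurable_w
      (m.integrable_w _ x)
    exact (integrable_base_singleton i x (measurable_integral_base _ m.measurable_w)).1 h
  hasDerivAt t := m.hasDerivAt_Z (Finset.notMem_erase i A) x t
  increment _ _ h := m.force_increment (Finset.notMem_erase i A) x h

/-- Integrating out the other free sites shows that the partition function with site `i` frozen is
the unnormalised density of spin `i`. This transfers the Poincaré inequality on the line to the
Gibbs measure. -/
lemma integral_law {A : Finset ι} {i : ι} (hi : i ∈ A) (x : ι → ℝ) {u : (ι → ℝ) → ℝ}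
    (hu : Measurable u) {C : ℝ} (hC : ∀ y, |u y| ≤ C) (hd : DependsOn u ((A.erase i)ᶜ : Set ι)) :
    ∫ t, u (update x i t) * m.Z (A.erase i) (update x i t)
      = m.Z A x * ∫ y, u y ∂m.gibbs A x := by
  rw [← m.integral_mul_w]
  have hdis : Disjoint {i} (A.erase i) := by simp
  have h := integral_base_union hdis x (hu.mul m.measurable_w)
    (m.integrable_mul_w (.of_bounded hu hC) _ x)
  rw [insert_erase_union hi] at h
  simp only [Pi.mul_apply] at h
  have hm := measurable_integral_base (A.erase i) (hu.mul m.measurable_w)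
  simp only [Pi.mul_apply] at hm
  rw [h, integral_base_singleton i x hm]
  refine integral_congr_ae (Filter.Eventually.of_forall fun t => ?_)
  simp only
  rw [m.integral_mul_w, integral_congr_ae (m.ae_eq_of_dependsOn hd _)]
  simp [mul_comm]

/-- The factor by which revealing one site may reduce variances. -/
def revealFactor : ℝ := revealConst m.K m.δ

lemma one_le_revealFactor : 1 ≤ m.revealFactor := by
  have := m.varBound_nonneg
  have h : 0 ≤ 16 * tailConst m.δ (2 * m.K / m.δ) ^ 2 * m.varBound := by positivity
  rw [revealFactor, revealConst]; exact le_add_of_nonneg_right h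

/-! ### Revealing sites -/

section Bounded

variable {g : (ι → ℝ) → ℝ} {C : ℝ}

lemma sq_bounded (hC : ∀ y, |g y| ≤ C) (y : ι → ℝ) : |g y ^ 2| ≤ C ^ 2 := by
  rw [abs_pow]; exact pow_le_pow_left₀ (abs_nonneg _) (hC y) 2

lemma variance_gibbs_eq (hg : Measurable g) (hC : ∀ y, |g y| ≤ C)
    (A : Finset ι) (x : ι → ℝ) :
    Var[g; m.gibbs A x] = (∫ y, g y ^ 2 ∂m.gibbs A x) - (∫ y, g y ∂m.gibbs A x) ^ 2 :=
  variance_eq_sub (m.memLp_gibbs (.of_bounded hg hC) A x)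

lemma measurable_variance (hg : Measurable g) (hC : ∀ y, |g y| ≤ C) (A : Finset ι) :
    Measurable fun x => Var[g; m.gibbs A x] := by
  simp only [m.variance_gibbs_eq hg hC]
  exact (m.measurable_integral_gibbs A (hg.pow_const 2)).sub
    ((m.measurable_integral_gibbs A hg).pow_const 2)

lemma variance_gibbs_le (hg : Measurable g) (hC : ∀ y, |g y| ≤ C)
    (A : Finset ι) (x : ι → ℝ) : Var[g; m.gibbs A x] ≤ C ^ 2 := by
  rw [m.variance_gibbs_eq hg hC]
  have := m.abs_integral_gibbs_le (A := A) (sq_bounded hC) x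
  have := le_abs_self (∫ y, g y ^ 2 ∂m.gibbs A x)
  nlinarith

lemma abs_variance_gibbs_le (hg : Measurable g) (hC : ∀ y, |g y| ≤ C)
    (A : Finset ι) (x : ι → ℝ) : |Var[g; m.gibbs A x]| ≤ C ^ 2 := by
  rw [abs_of_nonneg (variance_nonneg _ _)]
  exact m.variance_gibbs_le hg hC A x

lemma dependsOn_variance (g : (ι → ℝ) → ℝ) (A : Finset ι) :
    DependsOn (fun x => Var[g; m.gibbs A x]) (Aᶜ : Set ι) := by
  intro x x' h
  simp only [gibbs]
  rw [base_congr (A := A) (x := x) (x' := x') fun i hi => h i (by simpa using hi)]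

/-- Revealing a site outside the support of `g` reduces the variance of `g` by at most a constant
factor. -/
theorem variance_le_of_erase (hg : Measurable g) (hC : ∀ y, |g y| ≤ C)
    {A : Finset ι} {i : ι} (hi : i ∈ A)
    (hgi : DependsOn g ({i}ᶜ : Set ι)) (x : ι → ℝ) :
    Var[g; m.gibbs A x] ≤ m.revealFactor * ∫ y, Var[g; m.gibbs (A.erase i) y] ∂m.gibbs A x := by
  have hC0 : 0 ≤ C := (abs_nonneg _).trans (hC 0)
  have hgt : IsTame g := .of_bounded hg hC
  have hiA : i ∉ A.erase i := Finset.notMem_erase i A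
  set T := tailConst m.δ (2 * m.K / m.δ) with hT
  set G : (ι → ℝ) → ℝ := fun y => ∫ z, g z ∂m.gibbs (A.erase i) y with hG
  have hGm : Measurable G := m.measurable_integral_gibbs _ hg
  have hGC : ∀ y, |G y| ≤ C := m.abs_integral_gibbs_le hC
  have hδ := m.δ_pos
  have hK := m.K_nonneg
  have hCv := m.varBound_nonneg
  have hcov : ∀ y, cov[g, m.dH i; m.gibbs (A.erase i) y] ^ 2
      ≤ 4 * m.varBound * Var[g; m.gibbs (A.erase i) y] := fun y => by
    refine (covariance_sq_le (m.memLp_gibbs hgt _ _)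
      (m.memLp_gibbs (m.isTame_dH i) _ _)).trans ?_
    rw [mul_comm]
    exact mul_le_mul_of_nonneg_right (m.variance_dH_le hiA y) (variance_nonneg _ _)
  -- `poincare` asks for one bound valid for both the function and its derivative, hence the sum.
  have hcovB : ∀ y, |(-cov[g, m.dH i; m.gibbs (A.erase i) y])| ≤ C + √(4 * m.varBound * C ^ 2) :=
    fun y => by
      rw [abs_neg, ← Real.sqrt_sq_eq_abs]
      have h1 := Real.sqrt_le_sqrt ((hcov y).trans (mul_le_mul_of_nonneg_left
        (m.variance_gibbs_le hg hC _ y) (by positivity)))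
      linarith
  have hCB : ∀ y, |G y| ≤ C + √(4 * m.varBound * C ^ 2) := fun y =>
    (hGC y).trans (by linarith [Real.sqrt_nonneg (4 * m.varBound * C ^ 2)])
  obtain ⟨c, hc⟩ := (m.isNearlyLogConcave A i x).poincare hδ (by positivity)
    (f := fun t => G (update x i t))
    (fun t => m.hasDerivAt_integral_gibbs hiA hgt hgi x t) (fun t => hCB _) (fun t => hcovB _)
  have hGd : DependsOn G ((A.erase i)ᶜ : Set ι) := m.dependsOn_gibbs _ g
  have hVm := m.measurable_variance hg hC (A.erase i)
  have hVC := m.abs_variance_gibbs_le hg hC (A.erase i)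
  have hVd := m.dependsOn_variance g (A.erase i)
  have hGcC : ∀ y, |(G y - c) ^ 2| ≤ (C + |c|) ^ 2 := fun y => by
    rw [abs_pow]
    exact pow_le_pow_left₀ (abs_nonneg _) ((abs_sub _ _).trans (by linarith [hGC y])) 2
  have hGcm : Measurable fun y => (G y - c) ^ 2 := (hGm.sub_const c).pow_const 2
  have e1 := m.integral_law hi x hGcm hGcC fun y y' h => by simp only [hGd h]
  have e2 := m.integral_law hi x hVm hVC hVd
  rw [e1] at hc
  have hZ := m.Z_pos A x
  have h3 : ∫ t, (-cov[g, m.dH i; m.gibbs (A.erase i) (update x i t)]) ^ 2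
      * m.Z (A.erase i) (update x i t)
      ≤ 4 * m.varBound * (m.Z A x * ∫ y, Var[g; m.gibbs (A.erase i) y] ∂m.gibbs A x) := by
    rw [← e2, ← integral_const_mul]
    refine integral_mono_of_nonneg (Filter.Eventually.of_forall fun t =>
      mul_nonneg (sq_nonneg _) (m.Z_pos _ _).le) ?_ (Filter.Eventually.of_forall fun t => ?_)
    · refine Integrable.const_mul ?_ _
      refine (m.isNearlyLogConcave A i x).integrable.bdd_mul (c := C ^ 2)
        (hVm.comp (measurable_update x)).aestronglyMeasurable
        (Filter.Eventually.of_forall fun t => hVC _)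
    · simp only
      rw [neg_sq, ← mul_assoc]
      exact mul_le_mul_of_nonneg_right (hcov _) (m.Z_pos _ _).le
  -- The constant 16 combines the 4 of `poincare` with the 4 of `variance_dH_le`.
  have h4 : ∫ y, (G y - c) ^ 2 ∂m.gibbs A x
      ≤ 16 * T ^ 2 * m.varBound * ∫ y, Var[g; m.gibbs (A.erase i) y] ∂m.gibbs A x := by
    refine le_of_mul_le_mul_left (hc.trans ((mul_le_mul_of_nonneg_left h3
      (by positivity)).trans (le_of_eq ?_))) hZ
    ring
  -- Conditional bias–variance decomposition: given spin `i`, the second moment about `c` is the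
  -- conditional variance plus the squared bias of the conditional mean.
  have h5 : ∫ y, (g y - c) ^ 2 ∂m.gibbs A x
      = ∫ y, (Var[g; m.gibbs (A.erase i) y] + (G y - c) ^ 2) ∂m.gibbs A x := by
    have hb : ∀ y, |(g y - c) ^ 2| ≤ (C + |c|) ^ 2 := fun y => by
      rw [abs_pow]
      exact pow_le_pow_left₀ (abs_nonneg _) ((abs_sub _ _).trans (by linarith [hC y])) 2
    rw [← m.tower (Finset.erase_subset i A) ((hg.sub_const c).pow_const 2) hb x]
    refine integral_congr_ae (Filter.Eventually.of_forall fun y => ?_)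
    simp only
    have e3 := variance_eq_sub (m.memLp_gibbs (hgt.sub (.const c)) (A.erase i) y)
    rw [variance_sub_const hg.aestronglyMeasurable, integral_sub (m.integrable_gibbs hgt _ y)
      (integrable_const _)] at e3
    simp only [Pi.pow_apply, integral_const, probReal_univ, smul_eq_mul, one_mul] at e3
    rw [e3]
    ring
  calc Var[g; m.gibbs A x] ≤ ∫ y, (g y - c) ^ 2 ∂m.gibbs A x :=
        variance_le_integral_sub_sq (m.memLp_gibbs hgt A x) c
    _ = (∫ y, Var[g; m.gibbs (A.erase i) y] ∂m.gibbs A x)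
        + ∫ y, (G y - c) ^ 2 ∂m.gibbs A x := by
        rw [h5, integral_add (m.integrable_gibbs (.of_bounded hVm hVC) A x)
          (m.integrable_gibbs (.of_bounded hGcm hGcC) A x)]
    _ ≤ m.revealFactor * ∫ y, Var[g; m.gibbs (A.erase i) y] ∂m.gibbs A x := by
        rw [revealFactor, revealConst, add_mul, one_mul]
        exact add_le_add_right h4 _

/-- A function of the sites outside `B` is not well approximated by functions of the sites
in `B`. -/
theorem variance_le_integral_sub_sq_of_dependsOn (hg : Measurable g) (hC : ∀ y, |g y| ≤ C)
    {u : (ι → ℝ) → ℝ} (hu : Measurable u) {D : ℝ} (hD : ∀ y, |u y| ≤ D) (B : Finset ι) :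
    ∀ A : Finset ι, B ⊆ A → DependsOn g ((B : Set ι)ᶜ) → DependsOn u ((B : Set ι) ∪ (A : Set ι)ᶜ) →
      ∀ x, Var[g; m.gibbs A x] ≤ m.revealFactor ^ B.card * ∫ y, (g y - u y) ^ 2 ∂m.gibbs A x := by
  have hgt : IsTame g := .of_bounded hg hC
  induction B using Finset.induction_on with
  | empty =>
    intro A _ _ hud x
    -- With nothing left to reveal, `u` depends only on frozen sites and is a constant, and the
    -- variance is minimal among second moments about constants.
    have h1 : ∫ y, (g y - u y) ^ 2 ∂m.gibbs A x = ∫ y, (g y - u x) ^ 2 ∂m.gibbs A x := by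
      refine integral_congr_ae ?_
      filter_upwards [m.ae_eq_of_dependsOn (A := A) (u := u) (by simpa using hud) x] with y hy
      rw [hy]
    rw [h1]
    simpa using variance_le_integral_sub_sq (m.memLp_gibbs hgt A x) (u x)
  | insert b B hb ih =>
    intro A hA hgd hud x
    have hbA : b ∈ A := hA (Finset.mem_insert_self _ _)
    have hBA : B ⊆ A.erase b := fun j hj =>
      Finset.mem_erase.2 ⟨fun h => hb (h ▸ hj), hA (Finset.mem_insert_of_mem hj)⟩
    have h1 := m.variance_le_of_erase hg hC hbA (hgd.mono (by simp)) x
    have h2 : ∀ y, Var[g; m.gibbs (A.erase b) y]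
        ≤ m.revealFactor ^ B.card * ∫ z, (g z - u z) ^ 2 ∂m.gibbs (A.erase b) y := by
      refine ih (A.erase b) hBA (hgd.mono (by simp)) (hud.mono ?_)
      intro j hj
      by_cases hjb : j = b
      · simp [hjb]
      · simpa [hjb] using hj
    have hb' : ∀ y, |(g y - u y) ^ 2| ≤ (C + D) ^ 2 := fun y => by
      rw [abs_pow]
      exact pow_le_pow_left₀ (abs_nonneg _) ((abs_sub _ _).trans (add_le_add (hC y) (hD y))) 2
    have hm' : Measurable fun y => (g y - u y) ^ 2 := (hg.sub hu).pow_const 2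
    have h0 := zero_le_one.trans m.one_le_revealFactor
    refine h1.trans ?_
    rw [Finset.card_insert_of_notMem hb, pow_succ', mul_assoc]
    refine mul_le_mul_of_nonneg_left ?_ h0
    rw [← m.tower (Finset.erase_subset b A) hm' hb' x, ← integral_const_mul]
    exact integral_mono (m.integrable_gibbs (.of_bounded (m.measurable_variance hg hC _)
      (m.abs_variance_gibbs_le hg hC _)) A x)
      ((m.integrable_gibbs (.of_bounded (m.measurable_integral_gibbs _ hm')
        (m.abs_integral_gibbs_le hb')) A x).const_mul _) h2

end Bounded

/-! ### The Markov property -/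

section Markov

variable (m : Model ι)

/-- Frozen spins that differ have no coupling to `A`, so changing them shifts the energy by an
amount independent of the free spins `z`. Such a shift cancels against the partition function. -/
lemma H_piecewise_sub {A : Finset ι} {x x' : ι → ℝ}
    (h : ∀ i ∈ A, ∀ j ∉ A, m.M i j ≠ 0 → x j = x' j) (z : ι → ℝ) :
    m.H (A.piecewise z x) - m.H (A.piecewise z x')
      = m.H (A.piecewise 0 x) - m.H (A.piecewise 0 x') := by
  have key : ∀ z : ι → ℝ, m.H (A.piecewise z x) - m.H (A.piecewise z x')
      = ∑ i, (if i ∈ A then 0 else (m.ψb (x i) + m.s i * x i) - (m.ψb (x' i) + m.s i * x' i))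
        + 1 / 2 * ∑ i, ∑ j, (if i ∈ A then 0 else if j ∈ A then 0
            else m.M i j * (x i * x j) - m.M i j * (x' i * x' j)) := by
    intro z
    simp only [H, energy]
    rw [add_sub_add_comm, ← mul_sub, ← Finset.sum_sub_distrib, ← Finset.sum_sub_distrib]
    simp only [← Finset.sum_sub_distrib]
    congr 1
    · refine Finset.sum_congr rfl fun i _ => ?_
      by_cases hi : i ∈ A <;> simp [hi]
    · congr 1
      refine Finset.sum_congr rfl fun i _ => Finset.sum_congr rfl fun j _ => ?_
      by_cases hi : i ∈ A <;> by_cases hj : j ∈ A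
      · simp [hi, hj]
      · by_cases h0 : m.M i j = 0
        · simp [hi, h0]
        · simp [hi, hj, h i hi j hj h0]
      · by_cases h0 : m.M i j = 0
        · simp [hj, h0]
        · simp [hi, hj, h j hj i hi (by rwa [m.dominant.symm])]
      · simp [hi, hj]
  rw [key z, key 0]

/-- The Markov property: conditional expectations only depend on the boundary sites. -/
lemma integral_gibbs_congr {A : Finset ι} {x x' : ι → ℝ}
    (h : ∀ i ∈ A, ∀ j ∉ A, m.M i j ≠ 0 → x j = x' j) {g : (ι → ℝ) → ℝ} (hg : Measurable g)
    (hgA : DependsOn g (A : Set ι)) :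
    ∫ y, g y ∂m.gibbs A x = ∫ y, g y ∂m.gibbs A x' := by
  set κ := Real.exp (-(m.H (A.piecewise 0 x) - m.H (A.piecewise 0 x'))) with hκ
  have hw : ∀ z, m.w (A.piecewise z x) = κ * m.w (A.piecewise z x') := fun z => by
    rw [hκ, w, w, ← Real.exp_add, ← m.H_piecewise_sub h z]
    congr 1
    ring
  have hgz : ∀ z, g (A.piecewise z x) = g (A.piecewise z x') := fun z =>
    hgA fun i hi => by simp [Finset.mem_coe.1 hi]
  have e1 : ∫ y, g y * m.w y ∂base A x = κ * ∫ y, g y * m.w y ∂base A x' := by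
    have hm : Measurable fun y => g y * m.w y := hg.mul m.measurable_w
    rw [integral_base A x 0 hm, integral_base A x' 0 hm, ← integral_const_mul]
    refine integral_congr_ae (Filter.Eventually.of_forall fun z => ?_)
    simp only
    rw [hw, hgz]
    ring
  have e2 : m.Z A x = κ * m.Z A x' := by
    rw [Z, Z, integral_base A x 0 m.measurable_w, integral_base A x' 0 m.measurable_w,
      ← integral_const_mul]
    exact integral_congr_ae (Filter.Eventually.of_forall fun z => hw z)
  rw [integral_gibbs, integral_gibbs, e1, e2,
    mul_div_mul_left _ _ (Real.exp_pos _).ne']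

/-- The orthogonality property of conditional expectation: `u` is known once the coordinates outside
`B` are, so it passes through the inner mean. -/
lemma integral_mul_integral_gibbs {A B : Finset ι} (hBA : B ⊆ A) {u g : (ι → ℝ) → ℝ}
    (hu : Measurable u) {D : ℝ} (hD : ∀ y, |u y| ≤ D) (hud : DependsOn u (Bᶜ : Set ι))
    (hg : Measurable g) {C : ℝ} (hC : ∀ y, |g y| ≤ C) (x : ι → ℝ) :
    ∫ y, u y * (∫ z, g z ∂m.gibbs B y) ∂m.gibbs A x = ∫ y, u y * g y ∂m.gibbs A x := by
  have hb : ∀ y, |u y * g y| ≤ D * C := fun y => by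
    rw [abs_mul]
    exact mul_le_mul (hD y) (hC y) (abs_nonneg _) ((abs_nonneg _).trans (hD y))
  have hm : Measurable fun y => u y * g y := hu.mul hg
  rw [← m.tower hBA hm hb x]
  refine integral_congr_ae (Filter.Eventually.of_forall fun y => ?_)
  simp only
  rw [← integral_const_mul]
  refine integral_congr_ae ?_
  filter_upwards [m.ae_eq_of_dependsOn hud y] with z hz
  rw [hz]

end Markov

/-! ### Contraction along the chain -/

section Chain

variable {N : ℕ} (m : Model (Fin N))

/-- The sites `i` with `k ≤ i`. -/
def upper (N k : ℕ) : Finset (Fin N) := univ.filter fun i => k ≤ (i : ℕ)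

@[simp] lemma mem_upper {k : ℕ} {i : Fin N} : i ∈ upper N k ↔ k ≤ (i : ℕ) := by simp [upper]

lemma upper_subset {k l : ℕ} (h : k ≤ l) : upper N l ⊆ upper N k := fun i hi => by
  rw [mem_upper] at hi ⊢
  omega

/-- The sites below `k` at distance less than `r` from `k`. -/
def layer (N k r : ℕ) : Finset (Fin N) := univ.filter fun i => (i : ℕ) < k ∧ k < (i : ℕ) + r

@[simp] lemma mem_layer {k r : ℕ} {i : Fin N} :
    i ∈ layer N k r ↔ (i : ℕ) < k ∧ k < (i : ℕ) + r := by simp [layer]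

lemma card_layer_le (N k r : ℕ) : (layer N k r).card ≤ r := by
  rw [← Finset.card_map Fin.valEmbedding]
  have h : (layer N k r).map Fin.valEmbedding ⊆ Finset.Ico (k - r) k := by
    intro j hj
    simp only [Finset.mem_map, mem_layer, Fin.valEmbedding_apply] at hj
    obtain ⟨i, hi, rfl⟩ := hj
    rw [Finset.mem_Ico]
    omega
  refine (Finset.card_le_card h).trans ?_
  rw [Nat.card_Ico]
  omega

/-- The interaction has range less than `r`. -/
def HasRange (r : ℕ) : Prop := ∀ i j : Fin N, (i : ℕ) + r ≤ j → m.M i j = 0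

variable {m} {r : ℕ}

/-- By the Markov property only sites below `k` coupled to some site of `upper N k` matter. These
lie strictly within distance `r` of `k`, because coupling already vanishes at distance `r`. -/
lemma HasRange.dependsOn (hr : m.HasRange r) {k : ℕ} {g : (Fin N → ℝ) → ℝ} (hg : Measurable g)
    (hgd : DependsOn g (upper N k : Set (Fin N))) :
    DependsOn (fun y => ∫ z, g z ∂m.gibbs (upper N k) y) (layer N k r : Set (Fin N)) := by
  intro x x' h
  refine m.integral_gibbs_congr (fun i hi j hj hM => h j ?_) hg hgd
  rw [mem_upper] at hi hj
  rw [Finset.mem_coe, mem_layer]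
  refine ⟨by omega, ?_⟩
  by_contra hlt
  refine hM ?_
  rw [m.dominant.symm]
  exact hr j i (by omega)

/-- The conditional expectation given the sites below `k` contracts the variance of functions of
the other sites. -/
theorem HasRange.variance_integral_le (hr : m.HasRange r) {k : ℕ} {g : (Fin N → ℝ) → ℝ}
    (hg : Measurable g) {C : ℝ} (hC : ∀ y, |g y| ≤ C)
    (hgd : DependsOn g (upper N k : Set (Fin N))) (x : Fin N → ℝ) :
    Var[fun y => ∫ z, g z ∂m.gibbs (upper N k) y; m.gibbs univ x]
      ≤ (1 - (m.revealFactor ^ r)⁻¹) * Var[g; m.gibbs univ x] := by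
  set h : (Fin N → ℝ) → ℝ := fun y => ∫ z, g z ∂m.gibbs (upper N k) y with hh
  have hm : Measurable h := m.measurable_integral_gibbs _ hg
  have hb : ∀ y, |h y| ≤ C := m.abs_integral_gibbs_le hC
  have hgt : IsTame g := .of_bounded hg hC
  have hht : IsTame h := .of_bounded hm hb
  -- The conditional mean `h` is a function of the layer while `g` lives beyond it, so `h` cannot
  -- approximate `g` well.
  have h1 := m.variance_le_integral_sub_sq_of_dependsOn hg hC hm hb (layer N k r) univ
    (Finset.subset_univ _)
    (hgd.mono fun i hi => by
      have : k ≤ (i : ℕ) := by simpa using hi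
      simp; omega)
    ((hr.dependsOn hg hgd).mono Set.subset_union_left) x
  have hC1 := m.one_le_revealFactor
  have hpos : 0 < m.revealFactor ^ r := pow_pos (by linarith) r
  have h2 : Var[g; m.gibbs univ x] ≤ m.revealFactor ^ r * ∫ y, (g y - h y) ^ 2 ∂m.gibbs univ x :=
    h1.trans (mul_le_mul_of_nonneg_right (pow_le_pow_right₀ hC1 (card_layer_le N k r))
      (integral_nonneg fun _ => sq_nonneg _))
  have e1 : ∫ y, h y * h y ∂m.gibbs univ x = ∫ y, h y * g y ∂m.gibbs univ x :=
    m.integral_mul_integral_gibbs (Finset.subset_univ _) hm hb (m.dependsOn_gibbs _ g) hg hC x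
  have e2 : ∫ y, h y ∂m.gibbs univ x = ∫ y, g y ∂m.gibbs univ x :=
    m.tower (Finset.subset_univ _) hg hC x
  have i1 := m.integrable_gibbs (hgt.mul hgt) univ x
  have i2 := m.integrable_gibbs (hht.mul hgt) univ x
  have i3 := m.integrable_gibbs (hht.mul hht) univ x
  have i4 := m.integrable_gibbs ((hgt.mul hgt).add (hht.mul hht)) univ x
  have e3 : ∫ y, (g y - h y) ^ 2 ∂m.gibbs univ x
      = ∫ y, ((g y * g y + h y * h y) - 2 * (h y * g y)) ∂m.gibbs univ x :=
    integral_congr_ae (Filter.Eventually.of_forall fun y => by ring)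
  -- Pythagoras for the projection `h` of `g`; a lower bound on the residual is therefore a
  -- contraction of the variance.
  have e4 : ∫ y, (g y - h y) ^ 2 ∂m.gibbs univ x
      = Var[g; m.gibbs univ x] - Var[h; m.gibbs univ x] := by
    rw [e3, integral_sub i4 (i2.const_mul 2), integral_add i1 i3, integral_const_mul,
      m.variance_gibbs_eq hg hC, m.variance_gibbs_eq hm hb, e2, ← e1]
    simp only [sq]
    ring
  rw [e4, ← div_le_iff₀' hpos, div_eq_inv_mul] at h2
  linarith

/-- A bounded contraction of the real line. -/
structure IsTruncation (φ : ℝ → ℝ) (b : ℝ) : Prop where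
  measurable : Measurable φ
  bound : ∀ t, |φ t| ≤ b
  lipschitz : ∀ t u, |φ t - φ u| ≤ |t - u|

/-- The total of the truncated spins in `A`. -/
def truncSum (φ : ℝ → ℝ) (A : Finset (Fin N)) (y : Fin N → ℝ) : ℝ := ∑ i ∈ A, φ (y i)

variable {φ : ℝ → ℝ} {b : ℝ}

lemma IsTruncation.measurable_truncSum (hφ : IsTruncation φ b) (A : Finset (Fin N)) :
    Measurable (truncSum φ A) :=
  Finset.measurable_fun_sum _ fun i _ => hφ.measurable.comp (measurable_pi_apply i)

lemma IsTruncation.abs_truncSum_le (hφ : IsTruncation φ b) (A : Finset (Fin N)) (y : Fin N → ℝ) :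
    |truncSum φ A y| ≤ N * b := by
  refine (Finset.abs_sum_le_sum_abs _ _).trans ?_
  have h1 : ∑ i ∈ A, |φ (y i)| ≤ ∑ i, |φ (y i)| :=
    Finset.sum_le_sum_of_subset_of_nonneg (Finset.subset_univ A) fun _ _ _ => abs_nonneg _
  refine h1.trans ((Finset.sum_le_sum fun i _ => hφ.bound (y i)).trans ?_)
  simp

lemma IsTruncation.isTame_truncSum (hφ : IsTruncation φ b) (A : Finset (Fin N)) :
    IsTame (truncSum φ A) :=
  .of_bounded (hφ.measurable_truncSum A) (hφ.abs_truncSum_le A)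

lemma IsTruncation.isTame_coord (hφ : IsTruncation φ b) (i : Fin N) :
    IsTame fun y : Fin N → ℝ => φ (y i) :=
  .of_bounded (hφ.measurable.comp (measurable_pi_apply i)) fun _ => hφ.bound _

/-- A contraction does not increase variance: centre at `φ` of the mean and use the Lipschitz bound
pointwise. -/
lemma IsTruncation.variance_coord_le (hφ : IsTruncation φ b) (i : Fin N) (x : Fin N → ℝ) :
    Var[fun y => φ (y i); m.gibbs univ x] ≤ m.varBound := by
  set c := ∫ y, y i ∂m.gibbs univ x with hc
  have h1 := IsTame.coord (ι := Fin N) i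
  refine le_trans ?_ (m.variance_coord_le univ x i)
  refine (variance_le_integral_sub_sq (m.memLp_gibbs (hφ.isTame_coord i) univ x) (φ c)).trans ?_
  rw [variance_eq_integral h1.measurable.aemeasurable, ← hc]
  have t1 := (hφ.isTame_coord i).sub (.const (φ c))
  have t2 := h1.sub (.const c)
  refine integral_mono (by simpa only [sq] using m.integrable_gibbs (t1.mul t1) univ x)
    (by simpa only [sq] using m.integrable_gibbs (t2.mul t2) univ x) fun y => ?_
  exact sq_le_sq.2 (hφ.lipschitz _ _)

lemma IsTruncation.sqrt_variance_truncSum_le (hφ : IsTruncation φ b) (A : Finset (Fin N))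
    (x : Fin N → ℝ) :
    √Var[truncSum φ A; m.gibbs univ x] ≤ A.card * √m.varBound := by
  refine (sqrt_variance_sum_le A fun i _ => m.memLp_gibbs (hφ.isTame_coord i) univ x).trans ?_
  refine (Finset.sum_le_sum fun i _ => Real.sqrt_le_sqrt (hφ.variance_coord_le i x)).trans ?_
  simp

lemma dependsOn_truncSum (A : Finset (Fin N)) : DependsOn (truncSum φ A) (A : Set (Fin N)) :=
  fun _ _ h => Finset.sum_congr rfl fun i hi => by rw [h i hi]

lemma card_sdiff_upper_le (k r : ℕ) : (upper N k \ upper N (k + r)).card ≤ r := by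
  rw [← Finset.card_map Fin.valEmbedding]
  have h : (upper N k \ upper N (k + r)).map Fin.valEmbedding ⊆ Finset.Ico k (k + r) := by
    intro j hj
    simp only [Finset.mem_map, Finset.mem_sdiff, mem_upper, Fin.valEmbedding_apply] at hj
    obtain ⟨i, hi, rfl⟩ := hj
    rw [Finset.mem_Ico]
    omega
  refine (Finset.card_le_card h).trans ?_
  rw [Nat.card_Ico]
  omega

lemma truncSum_upper (φ : ℝ → ℝ) (k r : ℕ) (y : Fin N → ℝ) :
    truncSum φ (upper N k) y
      = truncSum φ (upper N k \ upper N (k + r)) y + truncSum φ (upper N (k + r)) y :=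
  (Finset.sum_sdiff (upper_subset (Nat.le_add_right k r))).symm

lemma upper_eq_empty {k : ℕ} (hk : N ≤ k) : upper N k = ∅ := by
  ext i
  have := i.isLt
  simp
  omega

/-- The contraction factor for standard deviations over `r` sites. -/
def contraction (m : Model (Fin N)) (r : ℕ) : ℝ := √(1 - (m.revealFactor ^ r)⁻¹)

lemma contraction_nonneg : 0 ≤ contraction m r := Real.sqrt_nonneg _

lemma contraction_lt_one : contraction m r < 1 := by
  have hpos : 0 < (m.revealFactor ^ r)⁻¹ :=
    inv_pos.2 (pow_pos (by linarith [m.one_le_revealFactor]) r)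
  rw [contraction, Real.sqrt_lt' one_pos]
  linarith

/-- Bounds the standard deviation of conditional expectations of sums of spins. -/
def responseConst (m : Model (Fin N)) (r : ℕ) : ℝ := r * √m.varBound / (1 - contraction m r)

lemma responseConst_nonneg : 0 ≤ responseConst m r :=
  div_nonneg (by positivity) (by linarith [contraction_lt_one (m := m) (r := r)])

/-- The total spin to the right of `k` is controlled by the configuration to the left of `k` only
up to a bounded amount. -/
lemma HasRange.sqrt_variance_condSum_le (hr : m.HasRange r) (hφ : IsTruncation φ b)
    (x : Fin N → ℝ) (n : ℕ) :
    ∀ k, N ≤ k + n * r →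
      √Var[fun y => ∫ z, truncSum φ (upper N k) z ∂m.gibbs (upper N k) y; m.gibbs univ x]
        ≤ responseConst m r := by
  induction n with
  | zero =>
    intro k hk
    rw [upper_eq_empty (by simpa using hk)]
    have h0 : Var[fun y => ∫ z, truncSum φ ∅ z ∂m.gibbs ∅ y; m.gibbs univ x] = 0 :=
      variance_eq_zero_of_ae_eq_const (c := 0)
        (Filter.Eventually.of_forall fun y => by simp [truncSum])
    rw [h0, Real.sqrt_zero]
    exact responseConst_nonneg
  | succ n ih =>
    intro k hk
    have ih' := ih (k + r) (by rw [add_mul, one_mul] at hk; omega)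
    set h : (Fin N → ℝ) → ℝ :=
      fun y => ∫ z, truncSum φ (upper N (k + r)) z ∂m.gibbs (upper N (k + r)) y with hh
    set F : (Fin N → ℝ) → ℝ := truncSum φ (upper N k \ upper N (k + r)) with hF
    have hSm := hφ.measurable_truncSum (upper N (k + r))
    have hSb := hφ.abs_truncSum_le (upper N (k + r))
    have hm : Measurable h := m.measurable_integral_gibbs _ hSm
    have hb : ∀ y, |h y| ≤ N * b := m.abs_integral_gibbs_le hSb
    have hFt : IsTame F := hφ.isTame_truncSum _
    have hht : IsTame h := .of_bounded hm hb
    have hsub : upper N (k + r) ⊆ upper N k := upper_subset (Nat.le_add_right k r)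
    -- By the tower property the sum beyond the next block may be replaced by its conditional mean
    -- `h`. The latter depends only on the layer inside that block, so the contraction applies to `F
    -- + h`.
    have e1 : (fun y => ∫ z, truncSum φ (upper N k) z ∂m.gibbs (upper N k) y)
        = fun y => ∫ z, (F z + h z) ∂m.gibbs (upper N k) y := by
      ext y
      simp only [truncSum_upper φ k r]
      rw [integral_add (m.integrable_gibbs hFt _ y)
        (m.integrable_gibbs (hφ.isTame_truncSum _) _ y),
        integral_add (m.integrable_gibbs hFt _ y) (m.integrable_gibbs hht _ y),
        m.tower hsub hSm hSb y]
    have hFhd : DependsOn (fun y => F y + h y) (upper N k : Set (Fin N)) := by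
      intro y y' hy
      have h1 : F y = F y' := dependsOn_truncSum _ fun i hi => hy i (by
        simp only [Finset.coe_sdiff] at hi
        exact hi.1)
      have h2 : h y = h y' := hr.dependsOn hSm (dependsOn_truncSum _) fun i hi => hy i (by
        rw [Finset.mem_coe, mem_layer] at hi
        rw [Finset.mem_coe, mem_upper]
        omega)
      simp only [h1, h2]
    have h3 := hr.variance_integral_le (hFt.add hht).measurable
      (C := N * b + N * b) (fun y => (abs_add_le _ _).trans
        (add_le_add (hφ.abs_truncSum_le _ y) (hb y))) hFhd x
    rw [e1]
    have hρ := contraction_nonneg (m := m) (r := r)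
    have hρ1 := contraction_lt_one (m := m) (r := r)
    set a : ℝ := r * √m.varBound with ha
    have ha0 : 0 ≤ a := by positivity
    have h4 : √Var[F; m.gibbs univ x] ≤ a := by
      refine (hφ.sqrt_variance_truncSum_le _ x).trans ?_
      refine mul_le_mul_of_nonneg_right ?_ (Real.sqrt_nonneg _)
      exact_mod_cast card_sdiff_upper_le k r
    have h5 := sqrt_variance_add_le (m.memLp_gibbs hFt univ x) (m.memLp_gibbs hht univ x)
    have h6 : √(1 - (m.revealFactor ^ r)⁻¹) * √Var[fun y => F y + h y; m.gibbs univ x]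
        ≤ contraction m r * (a + responseConst m r) :=
      mul_le_mul_of_nonneg_left (h5.trans (add_le_add h4 ih')) hρ
    have hinv : (m.revealFactor ^ r)⁻¹ ≤ 1 :=
      inv_le_one_of_one_le₀ (one_le_pow₀ m.one_le_revealFactor)
    refine (Real.sqrt_le_sqrt h3).trans ?_
    rw [Real.sqrt_mul (by linarith)]
    refine h6.trans ?_
    have h7 : 0 < 1 - contraction m r := by linarith
    have h8 : responseConst m r = a / (1 - contraction m r) := rfl
    -- With `D = a/(1 - ρ)`, the recursion `ρ (a + D) ≤ D` reduces to `ρ (2 - ρ) ≤ 1`, that is `(1 -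
    -- ρ)² ≥ 0`.
    rw [h8, le_div_iff₀ h7]
    have h9 : contraction m r * (a + a / (1 - contraction m r)) * (1 - contraction m r)
        = contraction m r * (2 - contraction m r) * a := by field_simp; ring
    rw [h9]
    nlinarith [sq_nonneg (1 - contraction m r)]

/-- The increase of the variance of the total spin per block of `r` sites. -/
def blockConst (m : Model (Fin N)) (r : ℕ) : ℝ :=
  (r * √m.varBound) ^ 2 + 2 * (r * √m.varBound) * responseConst m r

/-- Adding a block `F` to the sum `S` on its right adds `Var F + 2 cov(F, S)`. In the covariance `S`
may be replaced by its conditional mean, whose standard deviation is bounded by `responseConst`, so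
the increment does not depend on the length of the chain. -/
lemma HasRange.variance_truncSum_le (hr : m.HasRange r) (hφ : IsTruncation φ b)
    (x : Fin N → ℝ) (n : ℕ) :
    ∀ k, N ≤ k + n * r → Var[truncSum φ (upper N k); m.gibbs univ x] ≤ n * blockConst m r := by
  induction n with
  | zero =>
    intro k hk
    rw [upper_eq_empty (by simpa using hk)]
    have h0 : Var[truncSum φ (∅ : Finset (Fin N)); m.gibbs univ x] = 0 :=
      variance_eq_zero_of_ae_eq_const (c := 0)
        (Filter.Eventually.of_forall fun y => by simp [truncSum])
    simp [h0]
  | succ n ih =>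
    intro k hk
    have hk' : N ≤ k + r + n * r := by rw [add_mul, one_mul] at hk; omega
    have ih' := ih (k + r) hk'
    have hresp := hr.sqrt_variance_condSum_le hφ x n (k + r) hk'
    set S : (Fin N → ℝ) → ℝ := truncSum φ (upper N (k + r)) with hS
    set h : (Fin N → ℝ) → ℝ := fun y => ∫ z, S z ∂m.gibbs (upper N (k + r)) y with hh
    set F : (Fin N → ℝ) → ℝ := truncSum φ (upper N k \ upper N (k + r)) with hF
    have hSm : Measurable S := hφ.measurable_truncSum (upper N (k + r))
    have hSb : ∀ y, |S y| ≤ N * b := hφ.abs_truncSum_le (upper N (k + r))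
    have hht : IsTame h :=
      .of_bounded (m.measurable_integral_gibbs _ hSm) (m.abs_integral_gibbs_le hSb)
    have hFt : IsTame F := hφ.isTame_truncSum _
    have hSt : IsTame S := hφ.isTame_truncSum _
    have hFd : DependsOn F ((upper N (k + r) : Set (Fin N))ᶜ) :=
      (dependsOn_truncSum _).mono fun i hi => by
        simp only [Finset.coe_sdiff] at hi
        exact hi.2
    have e1 : ∫ y, F y * h y ∂m.gibbs univ x = ∫ y, F y * S y ∂m.gibbs univ x :=
      m.integral_mul_integral_gibbs (Finset.subset_univ _) hFt.measurable
        (hφ.abs_truncSum_le _) hFd hSm hSb x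
    have e2 : ∫ y, h y ∂m.gibbs univ x = ∫ y, S y ∂m.gibbs univ x :=
      m.tower (Finset.subset_univ _) hSm hSb x
    have e3 : cov[F, S; m.gibbs univ x] = cov[F, h; m.gibbs univ x] := by
      rw [covariance_eq_sub (m.memLp_gibbs hFt _ x) (m.memLp_gibbs hSt _ x),
        covariance_eq_sub (m.memLp_gibbs hFt _ x) (m.memLp_gibbs hht _ x), e2]
      simp only [Pi.mul_apply]
      rw [e1]
    have h4 : √Var[F; m.gibbs univ x] ≤ r * √m.varBound := by
      refine (hφ.sqrt_variance_truncSum_le _ x).trans ?_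
      refine mul_le_mul_of_nonneg_right ?_ (Real.sqrt_nonneg _)
      exact_mod_cast card_sdiff_upper_le k r
    have h5 : cov[F, S; m.gibbs univ x] ≤ r * √m.varBound * responseConst m r := by
      rw [e3]
      refine (le_abs_self _).trans ((abs_covariance_le (m.memLp_gibbs hFt _ x)
        (m.memLp_gibbs hht _ x)).trans ?_)
      exact mul_le_mul h4 hresp (Real.sqrt_nonneg _) (by positivity)
    have h6 : Var[F; m.gibbs univ x] ≤ (r * √m.varBound) ^ 2 := by
      rw [← Real.sq_sqrt (variance_nonneg F _)]
      exact pow_le_pow_left₀ (Real.sqrt_nonneg _) h4 2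
    have e4 : truncSum φ (upper N k) = fun y => F y + S y := by
      ext y; exact truncSum_upper φ k r y
    rw [e4, variance_fun_add (m.memLp_gibbs hFt _ x) (m.memLp_gibbs hSt _ x)]
    push_cast
    rw [add_mul, one_mul, blockConst]
    rw [blockConst] at ih'
    linarith

/-! ### Removal of the truncation -/

/-- Truncation of the real line at level `n`. -/
def clip (n : ℕ) (t : ℝ) : ℝ := max (-n) (min n t)

lemma abs_clip_le (n : ℕ) (t : ℝ) : |clip n t| ≤ |t| := by
  have hn : (0 : ℝ) ≤ n := n.cast_nonneg
  rw [clip, abs_le]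
  have h1 := neg_abs_le t
  have h2 := le_abs_self t
  have h3 := abs_nonneg t
  constructor
  · rcases le_total (n : ℝ) t with h | h
    · rw [min_eq_left h]; exact le_max_of_le_right (by linarith)
    · rw [min_eq_right h]; exact le_max_of_le_right h1
  · refine max_le (by linarith) ((min_le_right _ _).trans h2)

lemma isTruncation_clip (n : ℕ) : IsTruncation (clip n) n where
  measurable := by unfold clip; fun_prop
  bound t := by
    have hn : (0 : ℝ) ≤ n := n.cast_nonneg
    rw [clip, abs_le]
    exact ⟨le_max_left _ _, max_le (by linarith) (min_le_left _ _)⟩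
  lipschitz t u := by
    simp only [clip, max_comm (-(n : ℝ)), min_comm (n : ℝ)]
    exact (abs_sup_sub_sup_le_abs (min t (n : ℝ)) (min u (n : ℝ)) (-(n : ℝ))).trans
      (abs_inf_sub_inf_le_abs t u (n : ℝ))

lemma tendsto_clip (t : ℝ) : Filter.Tendsto (fun n => clip n t) Filter.atTop (nhds t) := by
  refine tendsto_const_nhds.congr' ?_
  obtain ⟨k, hk⟩ := exists_nat_ge |t|
  filter_upwards [Filter.eventually_ge_atTop k] with n hn
  have h1 : |t| ≤ n := hk.trans (by exact_mod_cast hn)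
  rw [abs_le] at h1
  rw [clip, min_eq_right h1.2, max_eq_right h1.1]

/-- The variance of the total spin grows at most linearly. -/
theorem HasRange.variance_sum_le (hr : m.HasRange r) (hr1 : 1 ≤ r) (x : Fin N → ℝ) :
    Var[fun y => ∑ i, y i; m.gibbs univ x] ≤ N * blockConst m r := by
  have hu : upper N 0 = univ := by ext i; simp
  have hle : ∀ n, Var[truncSum (clip n) univ; m.gibbs univ x] ≤ N * blockConst m r := fun n => by
    -- Taking `N` blocks is wasteful but enough, as `N ≤ N * r` for `r ≥ 1`.
    have := hr.variance_truncSum_le (isTruncation_clip n) x N 0 (by nlinarith)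
    rwa [hu] at this
  have hS : IsTame fun y : Fin N → ℝ => ∑ i, y i := .sum _ fun i _ => IsTame.coord i
  have hA : IsTame fun y : Fin N → ℝ => ∑ i, |y i| := .sum _ fun i _ => by
    obtain ⟨C, c, hC, hc, h⟩ := (IsTame.coord i).growth
    exact ⟨(measurable_pi_apply i).abs, C, c, hC, hc, fun y => by rw [abs_abs]; exact h y⟩
  have hlim : ∀ y : Fin N → ℝ, Filter.Tendsto (fun n => truncSum (clip n) univ y) Filter.atTop
      (nhds (∑ i, y i)) := fun y => tendsto_finsetSum _ fun i _ => tendsto_clip (y i)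
  have hbd : ∀ n (y : Fin N → ℝ), |truncSum (clip n) univ y| ≤ ∑ i, |y i| := fun n y =>
    (Finset.abs_sum_le_sum_abs _ _).trans (Finset.sum_le_sum fun i _ => abs_clip_le n (y i))
  have t1 := tendsto_integral_of_dominated_convergence (μ := m.gibbs univ x)
    (F := fun n => truncSum (clip n) univ) (f := fun y => ∑ i, y i) (fun y => ∑ i, |y i|)
    (fun n => ((isTruncation_clip n).measurable_truncSum _).aestronglyMeasurable)
    (m.integrable_gibbs hA univ x) (fun n => Filter.Eventually.of_forall (hbd n))
    (Filter.Eventually.of_forall hlim)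
  have t2 := tendsto_integral_of_dominated_convergence (μ := m.gibbs univ x)
    (F := fun n y => truncSum (clip n) univ y ^ 2) (f := fun y => (∑ i, y i) ^ 2)
    (fun y => (∑ i, |y i|) * ∑ i, |y i|)
    (fun n => (((isTruncation_clip n).measurable_truncSum _).pow_const 2).aestronglyMeasurable)
    (m.integrable_gibbs (hA.mul hA) univ x) (fun n => Filter.Eventually.of_forall fun y => by
      rw [Real.norm_eq_abs, abs_pow, sq]
      exact mul_le_mul (hbd n y) (hbd n y) (abs_nonneg _) (sum_abs_nonneg y))
    (Filter.Eventually.of_forall fun y => (hlim y).pow 2)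
  rw [variance_eq_sub (m.memLp_gibbs hS univ x)]
  refine le_of_tendsto (t2.sub (t1.pow 2)) (Filter.Eventually.of_forall fun n => ?_)
  rw [← m.variance_gibbs_eq ((isTruncation_clip n).measurable_truncSum _)
    ((isTruncation_clip n).abs_truncSum_le _)]
  exact hle n

end Chain

end Model

/-! ### Translation to the original model -/

/-- The bound on the variance of the total spin per site, in terms of the parameters. -/
def upperConst (K δ : ℝ) (r : ℕ) : ℝ :=
  (r * √(spinVarConst K δ)) ^ 2 + 2 * (r * √(spinVarConst K δ))
    * (r * √(spinVarConst K δ) / (1 - √(1 - (revealConst K δ ^ r)⁻¹)))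

lemma sum_eq_add_sum_neighbors {N R : ℕ} (i : Fin N) {f : Fin N → ℝ}
    (hf : ∀ j : Fin N, (R : ℤ) < |((i : ℕ) : ℤ) - ((j : ℕ) : ℤ)| → f j = 0) :
    ∑ j, f j = f i + ∑ j ∈ neighbors R i, f j := by
  rw [← Finset.add_sum_erase _ _ (mem_univ i)]
  congr 1
  symm
  refine Finset.sum_subset (fun j hj => ?_) fun j hj hj' => hf j ?_
  · simp only [neighbors, Finset.mem_filter, mem_univ, true_and] at hj
    refine Finset.mem_erase.2 ⟨fun h => ?_, mem_univ j⟩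
    simp [h] at hj
  · have hne : (j : ℕ) ≠ i := fun h => (Finset.ne_of_mem_erase hj) (Fin.ext h)
    simp only [neighbors, Finset.mem_filter, mem_univ, true_and, not_and] at hj'
    have h1 : 1 ≤ |((j : ℕ) : ℤ) - ((i : ℕ) : ℤ)| := by
      refine Int.one_le_abs ?_
      omega
    rw [abs_sub_comm]
    exact not_le.1 (hj' h1)

lemma IsInteraction.isDominant {N R : ℕ} {δ : ℝ} {M : Matrix (Fin N) (Fin N) ℝ}
    (hM : IsInteraction R δ M) : IsDominant δ M where
  diag := hM.diag
  symm := hM.symm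
  row i := by
    rw [sum_eq_add_sum_neighbors (R := R) i fun j hj => by rw [hM.range i j hj, abs_zero]]
    have := hM.dominant i
    rw [hM.diag] at this ⊢
    rw [abs_one]
    linarith

/-- The diagonal of `M` reproduces the quadratic part of `ψ`, and the tilt `σ` is a constant shift
of the external field. Hence bounds uniform in the field are uniform in `σ`. -/
lemma energy_eq {N R : ℕ} {δ : ℝ} {M : Matrix (Fin N) (Fin N) ℝ} (hM : IsInteraction R δ M)
    (ψb : ℝ → ℝ) (s : Fin N → ℝ) (σ : ℝ) (x : Fin N → ℝ) :
    -energy ψb M (fun i => s i - σ) x = σ * ∑ k, x k - hamiltonian ψb R M s x := by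
  have h : ∀ i, ∑ j, M i j * (x i * x j) = x i ^ 2 + ∑ j ∈ neighbors R i, M i j * x i * x j := by
    intro i
    rw [sum_eq_add_sum_neighbors (R := R) i fun j hj => by rw [hM.range i j hj, zero_mul],
      hM.diag]
    simp only [mul_assoc]
    ring
  simp only [energy, h, hamiltonian, singleSite, Finset.mul_sum, ← Finset.sum_add_distrib,
    ← Finset.sum_sub_distrib, ← Finset.sum_neg_distrib]
  refine Finset.sum_congr rfl fun i _ => ?_
  rw [mul_add, Finset.mul_sum]
  ring

end SpinSystem

end

theorem mainTheorem7 (ψb : ℝ → ℝ) (hψb : SpinSystem.IsBoundedPerturbation ψb)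
    (R : ℕ) (δ : ℝ) (hδ : 0 < δ) :
    ∃ C : ℝ, 0 < C ∧
      ∀ (N : ℕ), 1 ≤ N →
      ∀ (M : Matrix (Fin N) (Fin N) ℝ), SpinSystem.IsInteraction R δ M →
      ∀ (s : Fin N → ℝ) (σ : ℝ),
        IsProbabilityMeasure (SpinSystem.gce ψb R M s σ) ∧
        MemLp (fun x : Fin N → ℝ => ∑ k, x k) 2 (SpinSystem.gce ψb R M s σ) ∧
        1 / C ≤ 1 / (N : ℝ) * variance (fun x : Fin N → ℝ => ∑ k, x k)
          (SpinSystem.gce ψb R M s σ) ∧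
        1 / (N : ℝ) * variance (fun x : Fin N → ℝ => ∑ k, x k)
          (SpinSystem.gce ψb R M s σ) ≤ C := by
  obtain ⟨K₀, h0⟩ := hψb.bounded
  obtain ⟨K₁, h1⟩ := hψb.bounded_deriv
  obtain ⟨K₂, h2⟩ := hψb.bounded_deriv_deriv
  set K := max K₀ (max K₁ K₂) with hK
  have hB : SpinSystem.IsBoundedBy K ψb :=
    ⟨hψb.differentiable, hψb.differentiable_deriv, fun z => (h0 z).trans (le_max_left _ _),
      fun z => (h1 z).trans ((le_max_left _ _).trans (le_max_right _ _)),
      fun z => (h2 z).trans ((le_max_right _ _).trans (le_max_right _ _))⟩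
  have hK0 : 0 ≤ K := (abs_nonneg _).trans (hB.bound 0)
  set C := max (2 + K) (SpinSystem.upperConst K δ (R + 1)) with hC
  have hC2 : 2 + K ≤ C := le_max_left _ _
  have hCpos : 0 < C := by linarith
  refine ⟨C, hCpos, fun N hN M hM s σ => ?_⟩
  let m : SpinSystem.Model (Fin N) := ⟨ψb, K, δ, M, fun i => s i - σ, hδ, hB, hM.isDominant⟩
  have hg : SpinSystem.gce ψb R M s σ = m.gibbs Finset.univ 0 := by
    rw [SpinSystem.gce, SpinSystem.Model.gibbs, SpinSystem.base_univ]
    congr 1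
    ext x
    exact (SpinSystem.energy_eq hM ψb s σ x).symm
  -- Coupling may be nonzero at distance exactly `R`, hence the shift by one; it also makes the
  -- block length positive when `R = 0`.
  have hr : m.HasRange (R + 1) := fun i j hij => hM.range i j (by
    rw [abs_sub_comm, abs_of_nonneg (by omega)]
    omega)
  have hNpos : (0 : ℝ) < N := by exact_mod_cast hN
  have hlow := m.card_le_variance_sum 0
  have hup := hr.variance_sum_le (by omega) 0
  have hS : SpinSystem.IsTame fun x : Fin N → ℝ => ∑ k, x k :=
    .sum _ fun k _ => SpinSystem.IsTame.coord k
  rw [Fintype.card_fin] at hlow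
  rw [hg]
  refine ⟨inferInstance, m.memLp_gibbs hS _ _, ?_, ?_⟩
  · rw [one_div_mul_eq_div, div_le_div_iff₀ hCpos hNpos, one_mul, mul_comm]
    exact hlow.trans (mul_le_mul_of_nonneg_right hC2 (variance_nonneg _ _))
  · rw [one_div_mul_eq_div, div_le_iff₀' hNpos]
    -- For this model `blockConst m (R + 1)` unfolds to `upperConst K δ (R + 1)`, which involves
    -- neither `N`, `M`, `s` nor `σ`.
    exact hup.trans (mul_le_mul_of_nonneg_left (le_max_right _ _) hNpos.le)
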